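/- Let $n\ge 1$ and let $\Omega:\mathbb{R}^n\setminus\{0\}\to\mathbb{C}$ be homogeneous of degree zero, $C^\infty$ on $\mathbb{S}^{n-1}$, with $\int_{\mathbb{S}^{n-1}}\Omega\,d\sigma=0$ and $\Omega\not\equiv 0$. Let $T$ be the Calderón–Zygmund operator $$Tf(x)=\mathrm{p.v.}\int_{\mathbb{R}^n}K(x-y)f(y)\,dy,\qquad K(x)=\frac{\Omega(x)}{|x|^n},$$ where $\mathrm{p.v.}\int$ is the limit as $\varepsilon\to 0^+$ of the integrals over $\{|x-y|>\varepsilon\}$. For a locally integrable $b:\mathbb{R}^n\to\mathbb{C}$ let $[b,T]f=b\,Tf-T(bf)$ for $f\in C_c^\infty(\mathbb{R}^n)$. Let $0<\alpha<1$, $1<p<n/\alpha$ and $1/q=1/p-\alpha/n$. The following statements are equivalent: 1. $b\in\mathrm{Lip}_\alpha$, i.e. after modification on a null set, $\displaystyle\sup_{x,h\in\mathbb{R}^n,\,h\ne 0}\frac{|b(x+h)-b(x)|}{|h|^\alpha}<\infty$; 2. $[b,T]$ is a bounded operator from $L^p(\mathbb{R}^n)$ to $L^q(\mathbb{R}^n)$;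 3. $[b,T]$ is a bounded operator from $L^p(\mathbb{R}^n)$ to $L^{q,\infty}(\mathbb{R}^n)$, where $\|g\|_{L^{q,\infty}}=\sup_{\lambda>0}\lambda\,|\{x:|g(x)|>\lambda\}|^{1/q}$. Here $[b,T]$ is called a bounded operator from $L^p$ to $X$ ($X=L^q$ or $L^{q,\infty}$) if there are a linear operator $A$ defined on all of $L^p$ and a constant $C$ with $\|Af\|_X\le C\|f\|_{L^p}$ for all $f\in L^p$, such that for every $f\in C_c^\infty(\mathbb{R}^n)$ and almost every $x$ the principal values $Tf(x)$ and $T(bf)(x)$ exist and $Af(x)=b(x)Tf(x)-T(bf)(x)$. -/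

import Mathlib

open MeasureTheory Filter Topology
open scoped ContDiff

noncomputable section

/-- `Ω` is the angular part of a nontrivial smooth homogeneous Calderón-Zygmund kernel: it is
homogeneous of degree zero, smooth on the unit sphere, of mean zero on the unit sphere and not
identically zero there. For a function that is homogeneous of degree zero, smoothness on the sphere
is the same as smoothness away from the origin. `volume.toSphere` is the surface measure. -/
structure IsCZAngular {n : ℕ} (Ω : EuclideanSpace ℝ (Fin n) → ℂ) : Prop where
  homogeneous : ∀ (t : ℝ) (x : EuclideanSpace ℝ (Fin n)), 0 < t → Ω (t • x) = Ω x
  smooth : ContDiffOn ℝ ∞ Ω {0}ᶜ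
  mean_zero : ∫ x : Metric.sphere (0 : EuclideanSpace ℝ (Fin n)) 1, Ω x
      ∂((volume : Measure (EuclideanSpace ℝ (Fin n))).toSphere) = 0
  nontrivial : ∃ x : EuclideanSpace ℝ (Fin n), ‖x‖ = 1 ∧ Ω x ≠ 0

/-- The kernel `K(x) = Ω(x) / |x|ⁿ`. -/
def czKernel {n : ℕ} (Ω : EuclideanSpace ℝ (Fin n) → ℂ) (x : EuclideanSpace ℝ (Fin n)) : ℂ :=
  Ω x / ((‖x‖ ^ n : ℝ) : ℂ)

/-- The principal value `p.v. ∫ K(x - y) f(y) dy` exists at the point `x` and equals `v`,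
i.e. `Tf(x)` is defined and `Tf(x) = v`. -/
def HasSingularIntegral {n : ℕ} (Ω f : EuclideanSpace ℝ (Fin n) → ℂ)
    (x : EuclideanSpace ℝ (Fin n)) (v : ℂ) : Prop :=
  Tendsto (fun ε : ℝ => ∫ y in {y | ε < ‖x - y‖}, czKernel Ω (x - y) * f y) (𝓝[>] 0) (𝓝 v)

/-- `[b,T]f(x) = b(x) Tf(x) - T(bf)(x)` is defined and equals `v`. -/
def HasCommutator {n : ℕ} (Ω b f : EuclideanSpace ℝ (Fin n) → ℂ)
    (x : EuclideanSpace ℝ (Fin n)) (v : ℂ) : Prop :=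
  ∃ u w : ℂ, HasSingularIntegral Ω f x u ∧ HasSingularIntegral Ω (fun y => b y * f y) x w ∧
    v = b x * u - w

/-- The quasi-norm of the weak Lebesgue space `L^{q,∞}`:
the supremum over `t > 0` of `t |{x : |f(x)| > t}|^{1/q}`. -/
def weakLpNorm {n : ℕ} (q : ℝ) (f : EuclideanSpace ℝ (Fin n) → ℂ) : ENNReal :=
  ⨆ (t : ℝ) (_ : 0 < t), ENNReal.ofReal t * (volume {x | t < ‖f x‖}) ^ (1 / q)

/-- `[b,T]` is a bounded operator from `L^p` to the space of functions with finite (quasi-)norm `N`: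
there is a linear operator `A` on all of `L^p`, bounded from `L^p` to that space, with
`Af = bTf - T(bf)` almost everywhere for all `f` in the dense subspace of smooth compactly
supported functions. (For a general locally integrable `b` the product `bf` with
`f ∈ L^p` need not be locally integrable, so `[b,T]f` has a direct meaning only on such a subspace.) -/
def CommutatorBounded {n : ℕ} (Ω b : EuclideanSpace ℝ (Fin n) → ℂ) (p : ℝ)
    (N : (EuclideanSpace ℝ (Fin n) → ℂ) → ENNReal) : Prop :=
  ∃ A : Lp ℂ (ENNReal.ofReal p) (volume : Measure (EuclideanSpace ℝ (Fin n))) →ₗ[ℂ]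
      (EuclideanSpace ℝ (Fin n) →ₘ[volume] ℂ),
    (∃ C : NNReal, ∀ F, N (A F) ≤ C * eLpNorm F (ENNReal.ofReal p) volume) ∧
    ∀ f : EuclideanSpace ℝ (Fin n) → ℂ, ContDiff ℝ ∞ f → HasCompactSupport f →
      ∀ F : Lp ℂ (ENNReal.ofReal p) (volume : Measure (EuclideanSpace ℝ (Fin n))),
        F =ᵐ[volume] f → ∀ᵐ x, HasCommutator Ω b f x (A F x)

/-- `b ∈ Lip_α`, as an almost everywhere defined function: `b` agrees almost everywhere with a
function `g` for which `|g(x + h) - g(x)| / |h|^α` is bounded over all `x` and all `h ≠ 0`. -/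
def IsLip {n : ℕ} (α : ℝ) (b : EuclideanSpace ℝ (Fin n) → ℂ) : Prop :=
  ∃ g : EuclideanSpace ℝ (Fin n) → ℂ, b =ᵐ[volume] g ∧
    ∃ C : ℝ, ∀ x h : EuclideanSpace ℝ (Fin n), h ≠ 0 → ‖g (x + h) - g x‖ / ‖h‖ ^ α ≤ C

end

/-! ### Radial integrals and the Riesz potential -/

section RieszPotential

variable {E : Type*} [NormedAddCommGroup E] [NormedSpace ℝ E] [FiniteDimensional ℝ E]
  [MeasurableSpace E] [BorelSpace E]

local notation "dim" => Module.finrank ℝ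

/-! The implications are proved in the cycle 1 ⇒ 2 ⇒ 3 ⇒ 1.

Upper bound (1 ⇒ 2): a Hölder symbol tames the singularity, since |K(x - y)(b(x) - b(y))| is at most
a constant times |x - y|^(α - n). The commutator is then an absolutely convergent integral dominated
by the Riesz potential of |f|, and the Hardy-Littlewood-Sobolev inequality
`exists_lintegral_rieszPotential_rpow_le` gives the bound from L^p to L^q. The mean zero condition
enters only to show that principal values of smooth functions exist (`exists_hasSingularIntegral`),
so that this integral really is bTf - T(bf) (`hasCommutator_of_integrable`). The step 2 ⇒ 3 is
Chebyshev's inequality.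

Lower bound (3 ⇒ 1): fix a direction in which Ω does not vanish. If Q is a ball of radius r and Q' =
Q - re with a suitable e depending only on Ω and δ, then for x in Q and y in Q' the kernel K(x - y)
equals a nonzero constant κ of size r^(-n), up to relative error δ
(`IsCZAngular.exists_czKernel_approx`). For bounded f supported in Q' the commutator is therefore
κ(b(x)∫f - ∫bf), up to δ|κ|∫|b(x) - b(y)||f(y)|dy. Since q > 1, weak L^q controls the L^1 norm of
the commutator on Q.

Testing on the characteristic function of Q' and on a complex sign bounds the oscillation of b on Q
about its average over Q', and on Q' about its average over Q, each up to δ times D = ∫∫|b(x) -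
b(y)| over Q × Q'. These oscillations in turn bound D, so for small δ the error is absorbed
(`CommutatorBounded.exists_mean_oscillation_le`). The outcome is ∫_Q |b - c| = O(r^(n + α)), and
Campanato's theorem `exists_holder_of_mean_oscillation` turns this into Hölder continuity. -/

theorem lintegral_ofReal_fun_norm [Nontrivial E] (μ : Measure E) [μ.IsAddHaarMeasure]
    {f : ℝ → ℝ} (hf : ∀ t, 0 ≤ f t)
    (hint : IntegrableOn (fun y : ℝ => y ^ (dim E - 1) • f y) (Set.Ioi 0)) :
    ∫⁻ x, ENNReal.ofReal (f ‖x‖) ∂μ = ENNReal.ofReal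
      (dim E * μ.real (Metric.ball 0 1) * ∫ y in Set.Ioi (0 : ℝ), y ^ (dim E - 1) • f y) := by
  rw [← ofReal_integral_eq_lintegral_ofReal ((integrable_fun_norm_addHaar μ).2 hint)
    (ae_of_all _ fun x => hf _), integral_fun_norm_addHaar]
  simp [mul_assoc]

/-- `∫_{|x| ≤ R} |x|^s dx` for `s > -dim E`. -/
theorem lintegral_closedBall_norm_rpow [Nontrivial E] (μ : Measure E) [μ.IsAddHaarMeasure]
    {s R : ℝ} (hs : 0 < dim E + s) (hR : 0 < R) :
    ∫⁻ x, {x : E | ‖x‖ ≤ R}.indicator (fun x => ENNReal.ofReal (‖x‖ ^ s)) x ∂μ =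
      ENNReal.ofReal
        (dim E * μ.real (Metric.ball 0 1) / (dim E + s) * R ^ (dim E + s)) := by
  have hd : 0 < dim E := Module.finrank_pos
  have key : ∀ y ∈ Set.Ioi (0 : ℝ), y ^ (dim E - 1) • (Set.Iic R).indicator (fun t => |t| ^ s) y =
      (Set.Ioc 0 R).indicator (fun t => t ^ (dim E + s - 1)) y := by
    intro y hy
    have hy' : 0 < y := hy
    by_cases h : y ≤ R
    · rw [Set.indicator_of_mem (by exact h), Set.indicator_of_mem (by exact ⟨hy, h⟩),
        abs_of_pos hy', smul_eq_mul, ← Real.rpow_natCast, ← Real.rpow_add hy', Nat.cast_pred hd]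
      ring_nf
    · rw [Set.indicator_of_notMem (by exact h), Set.indicator_of_notMem (by exact fun h' => h h'.2),
        smul_zero]
  have hI : IntegrableOn (fun t : ℝ => t ^ (dim E + s - 1)) (Set.Ioc 0 R) :=
    (intervalIntegrable_iff_integrableOn_Ioc_of_le hR.le).1
      (intervalIntegral.intervalIntegrable_rpow' (by linarith))
  have h := lintegral_ofReal_fun_norm μ (f := (Set.Iic R).indicator (fun t => |t| ^ s))
    (fun t => Set.indicator_nonneg (fun t _ => by positivity) t) (by
      rw [integrableOn_congr_fun key measurableSet_Ioi]
      exact ((integrable_indicator_iff measurableSet_Ioc).2 hI).integrableOn)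
  rw [setIntegral_congr_fun measurableSet_Ioi key, setIntegral_indicator measurableSet_Ioc,
    Set.inter_eq_self_of_subset_right Set.Ioc_subset_Ioi_self,
    ← intervalIntegral.integral_of_le hR.le, integral_rpow (Or.inl (by linarith))] at h
  rw [Real.zero_rpow (by linarith)] at h
  convert h using 2
  · ext x
    by_cases hx : ‖x‖ ≤ R <;> simp [Set.indicator, hx]
  · ring_nf

/-- `∫_{|x| > R} |x|^s dx` for `s < -dim E`. -/
theorem lintegral_compl_closedBall_norm_rpow [Nontrivial E] (μ : Measure E) [μ.IsAddHaarMeasure]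
    {s R : ℝ} (hs : dim E + s < 0) (hR : 0 < R) :
    ∫⁻ x, {x : E | R < ‖x‖}.indicator (fun x => ENNReal.ofReal (‖x‖ ^ s)) x ∂μ =
      ENNReal.ofReal
        (dim E * μ.real (Metric.ball 0 1) / (-(dim E + s)) * R ^ (dim E + s)) := by
  have hd : 0 < dim E := Module.finrank_pos
  have key : ∀ y ∈ Set.Ioi (0 : ℝ), y ^ (dim E - 1) • (Set.Ioi R).indicator (fun t => |t| ^ s) y =
      (Set.Ioi R).indicator (fun t => t ^ (dim E + s - 1)) y := by
    intro y hy
    have hy' : 0 < y := hy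
    by_cases h : R < y
    · rw [Set.indicator_of_mem (by exact h), Set.indicator_of_mem (by exact h),
        abs_of_pos hy', smul_eq_mul, ← Real.rpow_natCast, ← Real.rpow_add hy', Nat.cast_pred hd]
      ring_nf
    · rw [Set.indicator_of_notMem (by exact h), Set.indicator_of_notMem (by exact h),
        smul_zero]
  have hI : IntegrableOn (fun t : ℝ => t ^ (dim E + s - 1)) (Set.Ioi R) :=
    integrableOn_Ioi_rpow_of_lt (by linarith) hR
  have h := lintegral_ofReal_fun_norm μ (f := (Set.Ioi R).indicator (fun t => |t| ^ s))
    (fun t => Set.indicator_nonneg (fun t _ => by positivity) t) (by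
      rw [integrableOn_congr_fun key measurableSet_Ioi]
      exact ((integrable_indicator_iff measurableSet_Ioi).2 hI).integrableOn)
  rw [setIntegral_congr_fun measurableSet_Ioi key, setIntegral_indicator measurableSet_Ioi,
    Set.inter_eq_self_of_subset_right (Set.Ioi_subset_Ioi hR.le),
    integral_Ioi_rpow_of_lt (by linarith) hR] at h
  convert h using 2
  · ext x
    by_cases hx : R < ‖x‖ <;> simp [Set.indicator, hx]
  · rw [sub_add_cancel, div_neg, neg_mul, neg_div, mul_neg, div_mul_eq_mul_div, mul_div_assoc]

/-- The layer cake formula for the power `u ^ r`, at a point. -/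
theorem lintegral_Ioi_rpow_indicator_lt {r : ℝ} (hr : 0 < r) (u : ENNReal) :
    ∫⁻ t in Set.Ioi (0 : ℝ), {t : ℝ | ENNReal.ofReal t < u}.indicator
      (fun t => ENNReal.ofReal (t ^ (r - 1))) t = u ^ r / ENNReal.ofReal r := by
  have hm : ∀ u : ENNReal, MeasurableSet {t : ℝ | ENNReal.ofReal t < u} := fun u =>
    measurableSet_lt ENNReal.measurable_ofReal measurable_const
  have fin : ∀ T : NNReal, 0 < T →
      ∫⁻ t in Set.Ioi (0 : ℝ), {t : ℝ | ENNReal.ofReal t < T}.indicator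
      (fun t => ENNReal.ofReal (t ^ (r - 1))) t = (T : ENNReal) ^ r / ENNReal.ofReal r := by
    intro T hT
    have hT' : (0 : ℝ) < T := hT
    have hset : {t : ℝ | ENNReal.ofReal t < T} ∩ Set.Ioi 0 = Set.Ioo 0 (T : ℝ) := by
      ext t
      simp only [Set.mem_inter_iff, Set.mem_ofPred_eq, Set.mem_Ioi, Set.mem_Ioo]
      rw [← ENNReal.ofReal_coe_nnreal, ENNReal.ofReal_lt_ofReal_iff hT']
      tauto
    rw [setLIntegral_indicator (hm _), hset, restrict_Ioo_eq_restrict_Ioc,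
      ← ofReal_integral_eq_lintegral_ofReal]
    · rw [← intervalIntegral.integral_of_le hT'.le, integral_rpow (Or.inl (by linarith)),
        sub_add_cancel, Real.zero_rpow hr.ne', sub_zero, ENNReal.ofReal_div_of_pos hr,
        ← ENNReal.ofReal_rpow_of_pos hT', ENNReal.ofReal_coe_nnreal]
    · exact (intervalIntegrable_iff_integrableOn_Ioc_of_le hT'.le).1
        (intervalIntegral.intervalIntegrable_rpow' (by linarith))
    · filter_upwards [ae_restrict_mem measurableSet_Ioc] with t ht
      have := ht.1
      positivity
  induction u with
  | top =>
    rw [ENNReal.top_rpow_of_pos hr, ENNReal.top_div_of_ne_top ENNReal.ofReal_ne_top]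
    refine ENNReal.eq_top_of_forall_nnreal_le fun a => ?_
    -- Chosen so that T^r / r ≥ a; the summand 1 keeps T positive when a = 0.
    set T : NNReal := (a * r.toNNReal + 1) ^ (r⁻¹) with hTdef
    have hT : 0 < T := by positivity
    calc (a : ENNReal) ≤ (T : ENNReal) ^ r / ENNReal.ofReal r := by
          rw [ENNReal.le_div_iff_mul_le (by simp [hr]) (by simp), hTdef,
            ← ENNReal.coe_rpow_of_nonneg _ hr.le, NNReal.rpow_inv_rpow hr.ne',
            ENNReal.ofReal]
          exact_mod_cast le_add_of_nonneg_right zero_le_one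
      _ = _ := (fin T hT).symm
      _ ≤ _ := by
          refine lintegral_mono fun t => ?_
          refine Set.indicator_le_indicator_of_subset (fun t _ => ?_) (fun _ => zero_le) t
          simp
  | coe T =>
    rcases eq_or_lt_of_le (zero_le (a := T)) with h | h
    · subst h
      simp [ENNReal.zero_rpow_of_pos hr]
    · exact fin T h

/-- The kernel of the Riesz potential of order `α`, up to normalization. -/
noncomputable def rieszKernel (E : Type*) [NormedAddCommGroup E] [NormedSpace ℝ E] (α : ℝ) (x : E) :
    ENNReal :=
  ENNReal.ofReal (‖x‖ ^ (α - dim E))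

omit [FiniteDimensional ℝ E] in
@[fun_prop]
theorem measurable_rieszKernel (α : ℝ) : Measurable (rieszKernel E α) := by
  unfold rieszKernel
  fun_prop

/-- The Riesz potential of order `α`, up to normalization. -/
noncomputable def rieszPotential (μ : Measure E) (α : ℝ) (f : E → ENNReal) (x : E) : ENNReal :=
  ∫⁻ y, rieszKernel E α (x - y) * f y ∂μ

theorem measurable_rieszPotential (μ : Measure E) [SFinite μ] (α : ℝ) {f : E → ENNReal}
    (hf : Measurable f) :
    Measurable (rieszPotential μ α f) := by
  unfold rieszPotential
  refine Measurable.lintegral_prod_right' (f := fun z : E × E => rieszKernel E α (z.1 - z.2) * f z.2) ?_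
  have h : Measurable fun z : E × E => z.1 - z.2 := by fun_prop
  exact ((measurable_rieszKernel α).comp h).mul (hf.comp measurable_snd)

theorem lintegral_rieszKernel_near [Nontrivial E] (μ : Measure E) [μ.IsAddHaarMeasure] {α R : ℝ}
    (hα : 0 < α) (hR : 0 < R) :
    ∫⁻ x, {x : E | ‖x‖ ≤ R}.indicator (rieszKernel E α) x ∂μ =
      ENNReal.ofReal (dim E * μ.real (Metric.ball 0 1) / α * R ^ α) := by
  have h := lintegral_closedBall_norm_rpow (E := E) μ (s := α - dim E) (R := R)
    (by linarith) hR
  rw [add_sub_cancel] at h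
  exact h

/-- The part of the Riesz potential of an `L^p` function away from the singularity. -/
theorem exists_lintegral_rieszKernel_far_le [Nontrivial E] (μ : Measure E) [μ.IsAddHaarMeasure]
    {α p q : ℝ} (hp : 1 < p) (hpq : 1 / q = 1 / p - α / dim E) (hq : 0 < q) :
    ∃ c : ℝ, 0 < c ∧ ∀ f : E → ENNReal, Measurable f → ∫⁻ y, f y ^ p ∂μ ≤ 1 → ∀ x : E, ∀ R : ℝ,
      0 < R → ∫⁻ y, {y : E | R < ‖y‖}.indicator (rieszKernel E α) (x - y) * f y ∂μ ≤
        ENNReal.ofReal (c * R ^ (-(dim E / q))) := by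
  have hd : (0 : ℝ) < dim E := by exact_mod_cast Module.finrank_pos (R := ℝ) (M := E)
  obtain ⟨p', hpp⟩ : ∃ p', p.HolderConjugate p' := ⟨_, Real.HolderConjugate.conjExponent hp⟩
  have hp'0 : 0 < p' := hpp.symm.pos
  have hinv : 1 / p + 1 / p' = 1 := by simpa using hpp.inv_add_inv_eq_one
  -- The relation between p and q says 1/p' = 1 - 1/q - α/d. So the p'-th power of the kernel is
  -- integrable at infinity exactly because q > 0, and Hölder's inequality yields the decay
  -- R^(-d/q).
  have hexp : dim E + (α - dim E) * p' = -(dim E / q) * p' := by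
    have h1 : 1 / p' = 1 - 1 / q - α / dim E := by linarith
    have : (1 - 1 / q - α / dim E) * p' = 1 := by rw [← h1]; field_simp
    have h2 : (dim E : ℝ) * ((1 - 1 / q - α / dim E) * p') = dim E := by rw [this, mul_one]
    field_simp at h2 ⊢
    linarith
  have hneg : dim E + (α - dim E) * p' < 0 := by
    rw [hexp]
    have := div_pos hd hq
    nlinarith
  have hv : 0 < μ.real (Metric.ball (0 : E) 1) :=
    ENNReal.toReal_pos (Metric.measure_ball_pos μ _ one_pos).ne' measure_ball_lt_top.ne
  set a : ℝ := dim E * μ.real (Metric.ball (0 : E) 1) / (-(dim E + (α - dim E) * p')) with ha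
  have ha0 : 0 < a := by
    have : 0 < -(dim E + (α - dim E) * p') := by linarith
    positivity
  refine ⟨a ^ (1 / p'), by positivity, fun f hf hf1 x R hR => ?_⟩
  have hRm : MeasurableSet {y : E | R < ‖y‖} := measurableSet_lt measurable_const measurable_norm
  have hker : Measurable ({y : E | R < ‖y‖}.indicator (rieszKernel E α)) :=
    (measurable_rieszKernel α).indicator hRm
  have hH := ENNReal.lintegral_mul_le_Lp_mul_Lq μ hpp.symm
    (f := fun y => {y : E | R < ‖y‖}.indicator (rieszKernel E α) (x - y)) (g := f)
    (hker.comp (measurable_const.sub measurable_id)).aemeasurable hf.aemeasurable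
  refine hH.trans ?_
  rw [lintegral_sub_left_eq_self (fun y => {y : E | R < ‖y‖}.indicator (rieszKernel E α) y ^ p') x]
  have e : ∀ y : E, {y : E | R < ‖y‖}.indicator (rieszKernel E α) y ^ p' =
      {y : E | R < ‖y‖}.indicator (fun y => ENNReal.ofReal (‖y‖ ^ ((α - dim E) * p'))) y := by
    intro y
    by_cases hy : R < ‖y‖
    · rw [Set.indicator_of_mem (by exact hy), Set.indicator_of_mem (by exact hy), rieszKernel,
        ENNReal.ofReal_rpow_of_nonneg (by positivity) hp'0.le, Real.rpow_mul (norm_nonneg _)]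
    · rw [Set.indicator_of_notMem (by exact hy), Set.indicator_of_notMem (by exact hy),
        ENNReal.zero_rpow_of_pos hp'0]
  simp_rw [e]
  rw [lintegral_compl_closedBall_norm_rpow μ hneg hR, ← ha, hexp,
    ENNReal.ofReal_rpow_of_nonneg (by positivity) (by positivity),
    Real.mul_rpow ha0.le (by positivity), ← Real.rpow_mul hR.le,
    mul_assoc, mul_one_div_cancel hp'0.ne', mul_one]
  calc _ ≤ ENNReal.ofReal (a ^ (1 / p') * R ^ (-(dim E / q : ℝ))) * 1 := by
        gcongr
        exact ENNReal.rpow_le_one hf1 (by positivity)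
    _ = _ := mul_one _

/-- The integral over all points of the near part of a Riesz potential. -/
theorem lintegral_lintegral_rieszKernel_near [Nontrivial E] (μ : Measure E) [μ.IsAddHaarMeasure]
    {α R : ℝ} (hα : 0 < α) (hR : 0 < R) {f : E → ENNReal} (hf : Measurable f) :
    ∫⁻ x, ∫⁻ y, {y : E | ‖y‖ ≤ R}.indicator (rieszKernel E α) (x - y) * f y ∂μ ∂μ =
      ENNReal.ofReal (dim E * μ.real (Metric.ball 0 1) / α * R ^ α) * ∫⁻ y, f y ∂μ := by
  have hRm : MeasurableSet {y : E | ‖y‖ ≤ R} := measurableSet_le measurable_norm measurable_const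
  have hker : Measurable ({y : E | ‖y‖ ≤ R}.indicator (rieszKernel E α)) :=
    (measurable_rieszKernel α).indicator hRm
  have hsub : Measurable fun z : E × E => z.1 - z.2 := by fun_prop
  rw [lintegral_lintegral_swap ((hker.comp hsub).mul (hf.comp measurable_snd)).aemeasurable,
    ← lintegral_const_mul _ hf]
  refine lintegral_congr fun y => ?_
  have hm : Measurable fun x => {y : E | ‖y‖ ≤ R}.indicator (rieszKernel E α) (x - y) :=
    hker.comp (measurable_id.sub_const y)
  rw [lintegral_mul_const _ hm,
    lintegral_sub_right_eq_self (fun x => {y : E | ‖y‖ ≤ R}.indicator (rieszKernel E α) x) y,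
    lintegral_rieszKernel_near μ hα hR]

end RieszPotential

/-! ### The Hardy-Littlewood-Sobolev inequality -/

section HardyLittlewoodSobolev

variable {E : Type*} [NormedAddCommGroup E] [NormedSpace ℝ E] [FiniteDimensional ℝ E]
  [MeasurableSpace E] [BorelSpace E]

local notation "dim" => Module.finrank ℝ

/-- Level sets of a Riesz potential of a normalized `L^p` function. -/
theorem exists_measure_lt_rieszPotential_le [Nontrivial E] (μ : Measure E) [μ.IsAddHaarMeasure]
    {α p q : ℝ} (hα : 0 < α) (hp : 1 < p) (hpq : 1 / q = 1 / p - α / dim E) (hq : 0 < q) :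
    ∃ M b : ℝ, 0 < M ∧ 0 < b ∧ ∀ f : E → ENNReal, Measurable f → ∫⁻ y, f y ^ p ∂μ ≤ 1 →
      ∀ t : ℝ, 0 < t → μ {x | ENNReal.ofReal t < rieszPotential μ α f x} ≤
        ENNReal.ofReal (M * t ^ (-1 - q * α / dim E)) *
          ∫⁻ y, {y | ENNReal.ofReal (b * t ^ (q / p)) < f y}.indicator f y ∂μ := by
  have hd : (0 : ℝ) < dim E := by exact_mod_cast Module.finrank_pos (R := ℝ) (M := E)
  obtain ⟨c, hc, hfar⟩ := exists_lintegral_rieszKernel_far_le (E := E) μ hp hpq hq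
  have hv : 0 < μ.real (Metric.ball (0 : E) 1) :=
    ENNReal.toReal_pos (Metric.measure_ball_pos μ _ one_pos).ne' measure_ball_lt_top.ne
  set c₁ : ℝ := dim E * μ.real (Metric.ball (0 : E) 1) / α with hc₁
  have hc₁0 : 0 < c₁ := by positivity
  set a : ℝ := (2 * c) ^ (q / dim E) with ha
  have ha0 : 0 < a := by positivity
  have hqd : q / dim E ≠ 0 := by positivity
  have hexp : 1 + q * α / dim E = q / p := by
    have : q * (1 / q) = q * (1 / p - α / dim E) := by rw [hpq]
    rw [mul_one_div_cancel hq.ne'] at this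
    rw [this]; ring
  refine ⟨4 * c₁ * a ^ α, 1 / (4 * c₁ * a ^ α), by positivity, by positivity,
    fun f hf hf1 t ht => ?_⟩
  -- The radius R makes the far part of the potential at most t/2. The cutoff s below makes the near
  -- part of the values f ≤ s at most t/4. Only `G`, the near part of the values f > s, is left to
  -- supply the last t/4, and its integral is explicit, so Markov's inequality applies.
  set R : ℝ := a * t ^ (-(q / dim E)) with hR
  have hR0 : 0 < R := by positivity
  have hRα : R ^ α = a ^ α * t ^ (-(q * α / dim E)) := by
    rw [hR, Real.mul_rpow ha0.le (by positivity), ← Real.rpow_mul ht.le]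
    ring_nf
  set s : ℝ := 1 / (4 * c₁ * a ^ α) * t ^ (q / p) with hs
  have hs0 : 0 < s := by positivity
  have hfar' : c * R ^ (-(dim E / q) : ℝ) = t / 2 := by
    rw [hR, ha, Real.mul_rpow (by positivity) (by positivity), ← Real.rpow_mul (by positivity),
      ← Real.rpow_mul ht.le, show q / dim E * -(dim E / q : ℝ) = -1 by field_simp,
      show -(q / dim E) * -(dim E / q : ℝ) = 1 by field_simp, Real.rpow_one, Real.rpow_neg_one]
    field_simp
  have hnear' : s * (c₁ * R ^ α) = t / 4 := by
    have : t ^ (q / p) * t ^ (-(q * α / dim E)) = t := by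
      rw [← Real.rpow_add ht, ← hexp, add_neg_cancel_right, Real.rpow_one]
    rw [hRα, hs]
    calc _ = (t ^ (q / p) * t ^ (-(q * α / dim E))) * (c₁ * a ^ α / (4 * c₁ * a ^ α)) := by ring
      _ = _ := by rw [this]; field_simp
  set fs : E → ENNReal := {y | ENNReal.ofReal s < f y}.indicator f with hfs
  have hfsm : Measurable fs := hf.indicator (measurableSet_lt measurable_const hf)
  have hRm : MeasurableSet {y : E | ‖y‖ ≤ R} := measurableSet_le measurable_norm measurable_const
  have hRm' : MeasurableSet {y : E | R < ‖y‖} := measurableSet_lt measurable_const measurable_norm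
  set kn : E → ENNReal := {y : E | ‖y‖ ≤ R}.indicator (rieszKernel E α) with hkn
  set kf : E → ENNReal := {y : E | R < ‖y‖}.indicator (rieszKernel E α) with hkf
  have hknm : Measurable kn := (measurable_rieszKernel α).indicator hRm
  have hkfm : Measurable kf := (measurable_rieszKernel α).indicator hRm'
  have hx : ∀ x : E, Measurable fun y => x - y := fun x => by fun_prop
  set G : E → ENNReal := fun x => ∫⁻ y, kn (x - y) * fs y ∂μ with hG
  have hGm : Measurable G := by
    refine Measurable.lintegral_prod_right' (f := fun z : E × E => kn (z.1 - z.2) * fs z.2) ?_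
    have h : Measurable fun z : E × E => z.1 - z.2 := by fun_prop
    exact (hknm.comp h).mul (hfsm.comp measurable_snd)
  have hle : ∀ x, rieszPotential μ α f x ≤ ENNReal.ofReal (3 / 4 * t) + G x := by
    intro x
    calc rieszPotential μ α f x
        ≤ ∫⁻ y, (kf (x - y) * f y + (kn (x - y) * ENNReal.ofReal s + kn (x - y) * fs y)) ∂μ := by
          refine lintegral_mono fun y => ?_
          by_cases h : R < ‖x - y‖
          · have : kf (x - y) = rieszKernel E α (x - y) := Set.indicator_of_mem (by exact h) _
            simp only [this]
            exact le_self_add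
          · have : kn (x - y) = rieszKernel E α (x - y) :=
              Set.indicator_of_mem (by exact not_lt.1 h) _
            simp only [this]
            refine le_add_left ?_
            rw [← mul_add]
            gcongr
            by_cases h' : ENNReal.ofReal s < f y
            · have : fs y = f y := Set.indicator_of_mem (by exact h') _
              rw [this]
              exact le_add_self
            · exact le_add_right (not_lt.1 h')
      _ = ∫⁻ y, kf (x - y) * f y ∂μ + ((∫⁻ y, kn (x - y) ∂μ) * ENNReal.ofReal s + G x) := by
          rw [lintegral_add_left (by exact (hkfm.comp (hx x)).mul hf),
            lintegral_add_left (by exact (hknm.comp (hx x)).mul measurable_const),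
            lintegral_mul_const _ (by exact hknm.comp (hx x))]
      _ ≤ ENNReal.ofReal (t / 2) + (ENNReal.ofReal (t / 4) + G x) := by
          gcongr
          · exact (hfar f hf hf1 x R hR0).trans (by rw [hfar'])
          · rw [lintegral_sub_left_eq_self kn x, hkn, lintegral_rieszKernel_near μ hα hR0,
              ← ENNReal.ofReal_mul (by positivity), mul_comm, hnear']
      _ = _ := by
          rw [← add_assoc, ← ENNReal.ofReal_add (by positivity) (by positivity)]
          ring_nf
  calc μ {x | ENNReal.ofReal t < rieszPotential μ α f x}
      ≤ μ {x | ENNReal.ofReal (t / 4) ≤ G x} := by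
        refine measure_mono fun x (hxt : ENNReal.ofReal t < _) => ?_
        have h := hxt.trans_le (hle x)
        rw [show t = 3 / 4 * t + t / 4 by ring, ENNReal.ofReal_add (by positivity) (by positivity)]
          at h
        ring_nf at h ⊢
        exact (lt_of_add_lt_add_left h).le
    _ ≤ (∫⁻ x, G x ∂μ) / ENNReal.ofReal (t / 4) :=
        meas_ge_le_lintegral_div hGm.aemeasurable (by simpa using ht) ENNReal.ofReal_ne_top
    _ = _ := by
        rw [hG, hkn, lintegral_lintegral_rieszKernel_near μ hα hR0 hfsm, ← hc₁,
          ENNReal.mul_div_right_comm, ← ENNReal.ofReal_div_of_pos (by positivity)]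
        congr 2
        rw [hRα, show (-1 - q * α / dim E : ℝ) = -(q * α / dim E) + -1 by ring, Real.rpow_add ht,
          Real.rpow_neg_one]
        field_simp

/-- The **Hardy-Littlewood-Sobolev inequality** for a normalized function. -/
theorem exists_lintegral_rieszPotential_rpow_le_of_le_one [Nontrivial E] (μ : Measure E)
    [μ.IsAddHaarMeasure] {α p q : ℝ} (hα : 0 < α) (hp : 1 < p)
    (hpq : 1 / q = 1 / p - α / dim E) (hq : 0 < q) :
    ∃ C : NNReal, ∀ f : E → ENNReal, Measurable f → ∫⁻ y, f y ^ p ∂μ ≤ 1 →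
      ∫⁻ x, rieszPotential μ α f x ^ q ∂μ ≤ C := by
  have hd : (0 : ℝ) < dim E := by exact_mod_cast Module.finrank_pos (R := ℝ) (M := E)
  have hp0 : 0 < p := by linarith
  obtain ⟨M, b, hM, hb, hlev⟩ := exists_measure_lt_rieszPotential_le (E := E) μ hα hp hpq hq
  have hexp : q * α / dim E = q / p - 1 := by
    have : q * (1 / q) = q * (1 / p - α / dim E) := by rw [hpq]
    rw [mul_one_div_cancel hq.ne'] at this
    rw [this]; ring
  -- The layer cake weight t^(q - 1) times the factor t^(-1 - qα/d) of the level set bound is t^(r -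
  -- 1). After exchanging integrals, integrating it over t < (f/b)^(p/q) gives a multiple of f^(p -
  -- 1), and the remaining factor f completes f^p.
  set r : ℝ := q * (1 - 1 / p) with hr
  have hr0 : 0 < r := mul_pos hq (by rw [sub_pos, div_lt_one hp0]; exact hp)
  set K : ENNReal := ENNReal.ofReal q * ENNReal.ofReal M *
    ((ENNReal.ofReal b)⁻¹ ^ (p / q * r) / ENNReal.ofReal r) with hK
  have hKtop : K ≠ ⊤ := by
    have h1 : (ENNReal.ofReal b)⁻¹ ^ (p / q * r) ≠ ⊤ :=
      ENNReal.rpow_ne_top_of_nonneg (by positivity) (by simpa using hb)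
    finiteness [ENNReal.ofReal_pos.2 hr0]
  refine ⟨K.toNNReal, fun f hf hf1 => ?_⟩
  rw [ENNReal.coe_toNNReal hKtop]
  have hI : Measurable (rieszPotential μ α f) := measurable_rieszPotential μ α hf
  have hpw : ∀ y : E, f y * (∫⁻ t in Set.Ioi (0 : ℝ),
      {t : ℝ | ENNReal.ofReal t < ((ENNReal.ofReal b)⁻¹ * f y) ^ (p / q)}.indicator
      (fun t => ENNReal.ofReal (t ^ (r - 1))) t) =
      (ENNReal.ofReal b)⁻¹ ^ (p / q * r) / ENNReal.ofReal r * f y ^ p := by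
    intro y
    rw [lintegral_Ioi_rpow_indicator_lt hr0, ← ENNReal.rpow_mul,
      ENNReal.mul_rpow_of_nonneg _ _ (by positivity)]
    have h1 : p / q * r = p - 1 := by rw [hr]; field_simp
    have h2 : f y ^ p = f y * f y ^ (p - 1) := by
      nth_rw 2 [← ENNReal.rpow_one (f y)]
      rw [← ENNReal.rpow_add_of_nonneg _ _ zero_le_one (by linarith)]
      congr 1; ring
    rw [h1, h2, div_eq_mul_inv, div_eq_mul_inv]
    ring
  have hset : ∀ t : ℝ, 0 < t → ∀ y, ENNReal.ofReal (b * t ^ (q / p)) < f y ↔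
      ENNReal.ofReal t < ((ENNReal.ofReal b)⁻¹ * f y) ^ (p / q) := by
    intro t ht y
    have hpq0 : 0 < p / q := by positivity
    have hb' : ENNReal.ofReal b ≠ 0 := by simpa using hb
    have e : ENNReal.ofReal t = (ENNReal.ofReal (t ^ (q / p))) ^ (p / q) := by
      rw [ENNReal.ofReal_rpow_of_pos (by positivity), ← Real.rpow_mul ht.le,
        show q / p * (p / q) = 1 by field_simp, Real.rpow_one]
    rw [e, ENNReal.rpow_lt_rpow_iff hpq0, ENNReal.ofReal_mul hb.le, mul_comm (ENNReal.ofReal b)⁻¹,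
      ← div_eq_mul_inv, ENNReal.lt_div_iff_mul_lt (Or.inl hb') (Or.inl ENNReal.ofReal_ne_top),
      mul_comm]
  have hm1 : MeasurableSet {z : E × ℝ | ENNReal.ofReal z.2 < rieszPotential μ α f z.1} :=
    measurableSet_lt (by fun_prop) (hI.comp measurable_fst)
  have hm2 : MeasurableSet {z : ℝ × E |
      ENNReal.ofReal z.1 < ((ENNReal.ofReal b)⁻¹ * f z.2) ^ (p / q)} :=
    measurableSet_lt (by fun_prop) (((hf.comp measurable_snd).const_mul _).pow_const _)
  calc ∫⁻ x, rieszPotential μ α f x ^ q ∂μ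
      = ENNReal.ofReal q * ∫⁻ x, (∫⁻ t in Set.Ioi (0 : ℝ),
          {t : ℝ | ENNReal.ofReal t < rieszPotential μ α f x}.indicator
          (fun t => ENNReal.ofReal (t ^ (q - 1))) t) ∂μ := by
        rw [← lintegral_const_mul' _ _ ENNReal.ofReal_ne_top]
        refine lintegral_congr fun x => ?_
        rw [lintegral_Ioi_rpow_indicator_lt hq, ENNReal.mul_div_cancel (by simpa using hq)
          ENNReal.ofReal_ne_top]
    _ = ENNReal.ofReal q * ∫⁻ t in Set.Ioi (0 : ℝ), ENNReal.ofReal (t ^ (q - 1)) *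
          μ {x | ENNReal.ofReal t < rieszPotential μ α f x} := by
        rw [lintegral_lintegral_swap]
        · congr 1
          refine lintegral_congr fun t => ?_
          rw [← lintegral_indicator_const (measurableSet_lt measurable_const hI)]
          rfl
        · refine Measurable.aemeasurable ?_
          exact Measurable.indicator (f := fun z : E × ℝ => ENNReal.ofReal (z.2 ^ (q - 1)))
            (by fun_prop) hm1
    _ ≤ ENNReal.ofReal q * ∫⁻ t in Set.Ioi (0 : ℝ), ENNReal.ofReal M * ∫⁻ y,
          {t : ℝ | ENNReal.ofReal t < ((ENNReal.ofReal b)⁻¹ * f y) ^ (p / q)}.indicator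
          (fun t => ENNReal.ofReal (t ^ (r - 1))) t * f y ∂μ := by
        refine mul_le_mul_right ?_ _
        refine setLIntegral_mono_ae' measurableSet_Ioi (ae_of_all _ fun t (ht : 0 < t) => ?_)
        calc _ ≤ _ := mul_le_mul_right (hlev f hf hf1 t ht) _
          _ = ENNReal.ofReal M * (ENNReal.ofReal (t ^ (r - 1)) * ∫⁻ y,
            {y | ENNReal.ofReal (b * t ^ (q / p)) < f y}.indicator f y ∂μ) := by
              rw [← mul_assoc, ← mul_assoc, ← ENNReal.ofReal_mul (by positivity),
                ← ENNReal.ofReal_mul (by positivity), mul_left_comm, ← Real.rpow_add ht, hexp, hr]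
              ring_nf
          _ = _ := by
              rw [← lintegral_const_mul' _ _ ENNReal.ofReal_ne_top]
              congr 1
              refine lintegral_congr fun y => ?_
              by_cases h : ENNReal.ofReal (b * t ^ (q / p)) < f y
              · rw [Set.indicator_of_mem (by exact h),
                  Set.indicator_of_mem (by exact (hset t ht y).1 h)]
              · rw [Set.indicator_of_notMem (by exact h),
                  Set.indicator_of_notMem (by exact fun h' => h ((hset t ht y).2 h')), mul_zero,
                  zero_mul]
    _ = ENNReal.ofReal q * (ENNReal.ofReal M * ∫⁻ y,
          (ENNReal.ofReal b)⁻¹ ^ (p / q * r) / ENNReal.ofReal r * f y ^ p ∂μ) := by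
        rw [lintegral_const_mul' _ _ ENNReal.ofReal_ne_top, lintegral_lintegral_swap]
        · congr 2
          refine lintegral_congr fun y => ?_
          rw [← hpw y, lintegral_mul_const, mul_comm]
          exact Measurable.indicator (by fun_prop)
            (measurableSet_lt ENNReal.measurable_ofReal measurable_const)
        · refine Measurable.aemeasurable ?_
          refine Measurable.mul ?_ (hf.comp measurable_snd)
          exact Measurable.indicator (f := fun z : ℝ × E => ENNReal.ofReal (z.1 ^ (r - 1)))
            (by fun_prop) hm2
    _ = K * ∫⁻ y, f y ^ p ∂μ := by
        rw [lintegral_const_mul _ (hf.pow_const p), hK]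
        ring
    _ ≤ K := by
        calc _ ≤ K * 1 := by gcongr
          _ = K := mul_one K

/-- The **Hardy-Littlewood-Sobolev inequality**. -/
theorem exists_lintegral_rieszPotential_rpow_le [Nontrivial E] (μ : Measure E)
    [μ.IsAddHaarMeasure] {α p q : ℝ} (hα : 0 < α) (hp : 1 < p)
    (hpq : 1 / q = 1 / p - α / dim E) (hq : 0 < q) :
    ∃ C : NNReal, ∀ f : E → ENNReal, AEMeasurable f μ → ∫⁻ y, f y ^ p ∂μ ≠ ⊤ →
      (∫⁻ x, rieszPotential μ α f x ^ q ∂μ) ^ (1 / q) ≤ C * (∫⁻ y, f y ^ p ∂μ) ^ (1 / p) := by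
  have hp0 : 0 < p := by linarith
  obtain ⟨C, hC⟩ := exists_lintegral_rieszPotential_rpow_le_of_le_one (E := E) μ hα hp hpq hq
  refine ⟨C ^ (1 / q), ?_⟩
  suffices H : ∀ f : E → ENNReal, Measurable f → ∫⁻ y, f y ^ p ∂μ ≠ ⊤ →
      (∫⁻ x, rieszPotential μ α f x ^ q ∂μ) ^ (1 / q) ≤
        (C ^ (1 / q) : NNReal) * (∫⁻ y, f y ^ p ∂μ) ^ (1 / p) by
    intro f hf hfin
    have e : rieszPotential μ α f = rieszPotential μ α (hf.mk f) := by
      ext x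
      refine lintegral_congr_ae ?_
      filter_upwards [hf.ae_eq_mk] with y hy
      rw [hy]
    have e' : ∫⁻ y, f y ^ p ∂μ = ∫⁻ y, hf.mk f y ^ p ∂μ := by
      refine lintegral_congr_ae ?_
      filter_upwards [hf.ae_eq_mk] with y hy
      rw [hy]
    rw [e, e']
    exact H _ hf.measurable_mk (e' ▸ hfin)
  intro f hf hfin
  set N : ENNReal := (∫⁻ y, f y ^ p ∂μ) ^ (1 / p) with hN
  have hNp : N ^ p = ∫⁻ y, f y ^ p ∂μ := by
    rw [hN, ← ENNReal.rpow_mul, one_div_mul_cancel hp0.ne', ENNReal.rpow_one]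
  have hNtop : N ≠ ⊤ := ENNReal.rpow_ne_top_of_nonneg (by positivity) hfin
  -- Dividing by the norm needs N ≠ 0; if N = 0 then f vanishes almost everywhere.
  by_cases hN0 : N = 0
  · have h0 : ∫⁻ y, f y ^ p ∂μ = 0 := by rw [← hNp, hN0, ENNReal.zero_rpow_of_pos hp0]
    rw [lintegral_eq_zero_iff (hf.pow_const p)] at h0
    have hz : rieszPotential μ α f = fun _ => 0 := by
      ext x
      rw [rieszPotential, lintegral_eq_zero_iff']
      · filter_upwards [h0] with y hy
        have : f y = 0 := by simpa [ENNReal.rpow_eq_zero_iff, hp0, hp0.not_gt] using hy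
        simp [this]
      · have hx : Measurable fun y => x - y := by fun_prop
        exact (((measurable_rieszKernel α).comp hx).mul hf).aemeasurable
    rw [hz]
    simp [hq]
  · have h1 : ∫⁻ y, (N⁻¹ * f y) ^ p ∂μ ≤ 1 := by
      simp_rw [ENNReal.mul_rpow_of_nonneg _ _ hp0.le]
      rw [lintegral_const_mul _ (hf.pow_const p), ← hNp, ← ENNReal.mul_rpow_of_nonneg _ _ hp0.le,
        ENNReal.inv_mul_cancel hN0 hNtop, ENNReal.one_rpow]
    have h2 := hC (fun y => N⁻¹ * f y) (hf.const_mul _) h1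
    have e : ∀ x, rieszPotential μ α f x = N * rieszPotential μ α (fun y => N⁻¹ * f y) x := by
      intro x
      rw [rieszPotential, rieszPotential, ← lintegral_const_mul' _ _ hNtop]
      refine lintegral_congr fun y => ?_
      calc _ = (N * N⁻¹) * (rieszKernel E α (x - y) * f y) := by
            rw [ENNReal.mul_inv_cancel hN0 hNtop, one_mul]
        _ = _ := by ring
    simp_rw [e, ENNReal.mul_rpow_of_nonneg _ _ hq.le]
    rw [lintegral_const_mul' _ _ (ENNReal.rpow_ne_top_of_nonneg hq.le hNtop),
      ENNReal.mul_rpow_of_nonneg _ _ (by positivity), ← ENNReal.rpow_mul,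
      mul_one_div_cancel hq.ne', ENNReal.rpow_one, mul_comm, ENNReal.coe_rpow_of_nonneg _
      (by positivity)]
    gcongr

end HardyLittlewoodSobolev

/-! ### The kernel and existence of principal values -/

section CZKernel

variable {n : ℕ} {Ω : EuclideanSpace ℝ (Fin n) → ℂ}

local notation "𝔼" n:max => EuclideanSpace ℝ (Fin n)

theorem IsCZAngular.dim_pos (hΩ : IsCZAngular Ω) : 0 < n := by
  obtain ⟨x, hx, -⟩ := hΩ.nontrivial
  rcases Nat.eq_zero_or_pos n with rfl | h
  · rw [Subsingleton.elim x 0, norm_zero] at hx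
    exact absurd hx zero_ne_one
  · exact h

theorem IsCZAngular.measurable (hΩ : IsCZAngular Ω) : Measurable Ω := by
  have h : ContinuousOn Ω {0}ᶜ := hΩ.smooth.continuousOn
  have e : Ω = Set.piecewise {0}ᶜ Ω (fun _ => Ω 0) := by
    ext x
    by_cases hx : x = 0 <;> simp [Set.piecewise, hx]
  rw [e]
  exact h.measurable_piecewise continuousOn_const (measurableSet_singleton _).compl

theorem IsCZAngular.measurable_czKernel (hΩ : IsCZAngular Ω) : Measurable (czKernel Ω) := by
  unfold czKernel
  exact hΩ.measurable.div (Complex.measurable_ofReal.comp (measurable_norm.pow_const n))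

theorem IsCZAngular.exists_norm_le (hΩ : IsCZAngular Ω) : ∃ B : ℝ, 0 < B ∧ ∀ x, ‖Ω x‖ ≤ B := by
  obtain ⟨B, hB⟩ := (isCompact_sphere (0 : 𝔼 n) 1).exists_bound_of_continuousOn
    (f := Ω) (hΩ.smooth.continuousOn.mono fun x hx => by
      rintro rfl
      simp at hx)
  -- Homogeneity leaves the value at the origin arbitrary, so it enters the maximum separately; the
  -- 1 makes the bound positive.
  refine ⟨max (max B ‖Ω 0‖) 1, by positivity, fun x => ?_⟩
  by_cases hx : x = 0
  · subst hx
    exact (le_max_right _ _).trans (le_max_left _ _)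
  · rw [← hΩ.homogeneous ‖x‖⁻¹ x (by positivity)]
    exact (hB _ (by simp [norm_smul, hx])).trans ((le_max_left _ _).trans (le_max_left _ _))

/-- This is the convention z / 0 = 0; positivity of n matters because 0 ^ 0 = 1. -/
theorem czKernel_zero (hn : 0 < n) : czKernel Ω 0 = 0 := by
  simp [czKernel, hn.ne']

theorem norm_czKernel_mul_rpow_le {B : ℝ} (hB : ∀ x, ‖Ω x‖ ≤ B) (hn : 0 < n) (α : ℝ) (x : 𝔼 n) :
    ‖czKernel Ω x‖ * ‖x‖ ^ α ≤ B * ‖x‖ ^ (α - n) := by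
  have hB0 : 0 ≤ B := (norm_nonneg _).trans (hB 0)
  by_cases hx : x = 0
  · subst hx
    rw [czKernel_zero hn, norm_zero, zero_mul]
    positivity
  · have hx' : 0 < ‖x‖ := norm_pos_iff.2 hx
    rw [czKernel, norm_div, Complex.norm_real, Real.norm_of_nonneg (by positivity),
      Real.rpow_sub hx', Real.rpow_natCast, div_mul_eq_mul_div, mul_div_assoc]
    gcongr
    exact hB x

theorem norm_czKernel_le {B : ℝ} (hB : ∀ x, ‖Ω x‖ ≤ B) {x : 𝔼 n} {ε : ℝ} (hε : 0 < ε)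
    (hx : ε ≤ ‖x‖) : ‖czKernel Ω x‖ ≤ B / ε ^ n := by
  have hB0 : 0 ≤ B := (norm_nonneg _).trans (hB 0)
  rw [czKernel, norm_div, Complex.norm_real, Real.norm_of_nonneg (by positivity)]
  gcongr
  exact hB x

/-- In polar coordinates the integral is a product whose spherical factor is the mean of Ω. The
product formula `integral_prod_mul` needs no integrability, so ε may be any real number. -/
theorem IsCZAngular.integral_annulus (hΩ : IsCZAngular Ω) (ε : ℝ) :
    ∫ x, {x : 𝔼 n | ε < ‖x‖ ∧ ‖x‖ ≤ 1}.indicator (czKernel Ω) x = 0 := by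
  set g : Set.Ioi (0 : ℝ) → ℂ := fun r =>
    {r : ℝ | ε < r ∧ r ≤ 1}.indicator (fun r => (((r ^ n : ℝ) : ℂ))⁻¹) r.1 with hg
  have e1 : ∫ x, {x : 𝔼 n | ε < ‖x‖ ∧ ‖x‖ ≤ 1}.indicator (czKernel Ω) x =
      ∫ x : ({0}ᶜ : Set (𝔼 n)), {x : 𝔼 n | ε < ‖x‖ ∧ ‖x‖ ≤ 1}.indicator (czKernel Ω) x.1
        ∂(volume.comap Subtype.val) := by
    have : Nontrivial (𝔼 n) := by
      have : Nonempty (Fin n) := ⟨⟨0, hΩ.dim_pos⟩⟩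
      infer_instance
    rw [integral_subtype_comap (measurableSet_singleton _).compl
      fun x => {x : 𝔼 n | ε < ‖x‖ ∧ ‖x‖ ≤ 1}.indicator (czKernel Ω) x, restrict_compl_singleton]
  have e2 := (volume : Measure (𝔼 n)).measurePreserving_homeomorphUnitSphereProd.integral_comp
    (Homeomorph.measurableEmbedding _) (fun z => Ω z.1.1 * g z.2)
  have e3 := integral_prod_mul (μ := (volume : Measure (𝔼 n)).toSphere)
    (ν := Measure.volumeIoiPow (Module.finrank ℝ (𝔼 n) - 1)) (fun x => Ω x.1) g
  rw [hΩ.mean_zero, zero_mul] at e3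
  rw [e3] at e2
  rw [e1, ← e2]
  refine integral_congr_ae (ae_of_all _ ?_)
  rintro ⟨x, hx⟩
  have hx' : 0 < ‖x‖ := norm_pos_iff.2 hx
  have h1 : ((homeomorphUnitSphereProd (𝔼 n) ⟨x, hx⟩).1 : 𝔼 n) = ‖x‖⁻¹ • x := by simp
  have h2 : ((homeomorphUnitSphereProd (𝔼 n) ⟨x, hx⟩).2 : ℝ) = ‖x‖ := by simp
  simp only [hg, h1, h2]
  rw [hΩ.homogeneous _ _ (inv_pos.2 hx')]
  by_cases h : ε < ‖x‖ ∧ ‖x‖ ≤ 1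
  · rw [Set.indicator_of_mem (by exact h), Set.indicator_of_mem (by exact h), czKernel,
      div_eq_mul_inv]
  · rw [Set.indicator_of_notMem (by exact h), Set.indicator_of_notMem (by exact h), mul_zero]

theorem measurableSet_lt_norm_sub (x : 𝔼 n) (ε : ℝ) : MeasurableSet {y : 𝔼 n | ε < ‖x - y‖} :=
  measurableSet_lt measurable_const (by fun_prop)

/-- Truncations of an integrable function near a point. -/
theorem tendsto_setIntegral_lt_norm_sub (hn : 0 < n) {φ : 𝔼 n → ℂ} (hφ : Integrable φ) (x : 𝔼 n) :
    Tendsto (fun ε : ℝ => ∫ y in {y | ε < ‖x - y‖}, φ y) (𝓝[>] 0) (𝓝 (∫ y, φ y)) := by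
  have : Nontrivial (𝔼 n) := by
    have : Nonempty (Fin n) := ⟨⟨0, hn⟩⟩
    infer_instance
  have hc : AECover (volume : Measure (𝔼 n)) (𝓝[>] (0 : ℝ)) fun ε => {y | ε < ‖x - y‖} := by
    refine ⟨?_, fun ε => measurableSet_lt_norm_sub x ε⟩
    have h0 : ∀ᵐ y : 𝔼 n, y ≠ x := by
      simp [ae_iff]
    filter_upwards [h0] with y hy
    have : 0 < ‖x - y‖ := norm_pos_iff.2 (sub_ne_zero.2 hy.symm)
    exact mem_nhdsWithin_of_mem_nhds (gt_mem_nhds this)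
  exact hc.integral_tendsto_of_countably_generated hφ

theorem integrable_indicator_rpow_norm_sub (hn : 0 < n) {α : ℝ} (hα : 0 < α) (x : 𝔼 n) :
    Integrable (fun y => {y : 𝔼 n | ‖y‖ ≤ 1}.indicator (fun y => ‖y‖ ^ (α - n)) (x - y)) := by
  have : Nontrivial (𝔼 n) := by
    have : Nonempty (Fin n) := ⟨⟨0, hn⟩⟩
    infer_instance
  have hm : Measurable ({y : 𝔼 n | ‖y‖ ≤ 1}.indicator (fun y => ‖y‖ ^ (α - n))) :=
    Measurable.indicator (by fun_prop) (measurableSet_le measurable_norm measurable_const)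
  refine Integrable.comp_sub_left (f := {y : 𝔼 n | ‖y‖ ≤ 1}.indicator (fun y => ‖y‖ ^ (α - n))) ?_ x
  refine ⟨hm.aestronglyMeasurable, ?_⟩
  have h := lintegral_rieszKernel_near (E := 𝔼 n) volume hα one_pos
  rw [HasFiniteIntegral]
  calc _ = _ := by
        rw [← h]
        refine lintegral_congr fun y => ?_
        by_cases hy : ‖y‖ ≤ 1
        · rw [Set.indicator_of_mem (by exact hy), Set.indicator_of_mem (by exact hy), rieszKernel,
            finrank_euclideanSpace_fin, Real.enorm_of_nonneg (by positivity)]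
        · rw [Set.indicator_of_notMem (by exact hy), Set.indicator_of_notMem (by exact hy),
            enorm_zero]
    _ < ⊤ := ENNReal.ofReal_lt_top

theorem integrableOn_czKernel_mul (hΩ : IsCZAngular Ω) {f : 𝔼 n → ℂ} (hf : Integrable f) (x : 𝔼 n)
    {ε : ℝ} (hε : 0 < ε) :
    IntegrableOn (fun y => czKernel Ω (x - y) * f y) {y | ε < ‖x - y‖} := by
  obtain ⟨B, hB0, hB⟩ := hΩ.exists_norm_le
  refine Integrable.bdd_mul (c := B / ε ^ n) hf.integrableOn ?_ ?_
  · exact (hΩ.measurable_czKernel.comp (by fun_prop : Measurable fun y => x - y)).aestronglyMeasurable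
  · filter_upwards [ae_restrict_mem (measurableSet_lt_norm_sub x ε)] with y hy
    exact norm_czKernel_le hB hε (le_of_lt hy)

/-- Principal values of Lipschitz integrable functions exist. -/
theorem exists_hasSingularIntegral (hΩ : IsCZAngular Ω) {f : 𝔼 n → ℂ} (hf : Integrable f)
    {C : NNReal} (hC : LipschitzWith C f) (x : 𝔼 n) : ∃ u, HasSingularIntegral Ω f x u := by
  obtain ⟨B, hB0, hB⟩ := hΩ.exists_norm_le
  have hn := hΩ.dim_pos
  have hsub : Measurable fun y : 𝔼 n => x - y := by fun_prop
  have hKm : Measurable fun y : 𝔼 n => czKernel Ω (x - y) := hΩ.measurable_czKernel.comp hsub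
  have hS : MeasurableSet {y : 𝔼 n | ‖y‖ ≤ 1} := measurableSet_le measurable_norm measurable_const
  -- The value f(x), cut off to the unit ball about x. By cancellation on annuli, subtracting it
  -- leaves all truncated integrals unchanged. The difference is absolutely integrable against the
  -- kernel: near x by the Lipschitz bound, with singularity |x - y|^(1 - n), and away from x
  -- because f is integrable and K is bounded there.
  set c : 𝔼 n → ℂ := fun y => {y : 𝔼 n | ‖y‖ ≤ 1}.indicator (fun _ => f x) (x - y) with hc
  have hcm : Measurable c := (measurable_const.indicator hS).comp hsub
  have hφ : Integrable (fun y => czKernel Ω (x - y) * (f y - c y)) := by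
    refine Integrable.mono' (((integrable_indicator_rpow_norm_sub hn one_pos x).const_mul
      (B * C)).add (hf.norm.const_mul B)) ?_ ?_
    · exact hKm.aestronglyMeasurable.mul (hf.aestronglyMeasurable.sub hcm.aestronglyMeasurable)
    · refine ae_of_all _ fun y => ?_
      rw [norm_mul]
      by_cases hy : ‖x - y‖ ≤ 1
      · have h1 : c y = f x := Set.indicator_of_mem (by exact hy) _
        simp only [Pi.add_apply]
        rw [h1, Set.indicator_of_mem (by exact hy)]
        refine le_add_of_le_of_nonneg ?_ (by positivity)
        have h2 : ‖f y - f x‖ ≤ C * ‖x - y‖ := by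
          rw [norm_sub_rev x y]
          exact hC.norm_sub_le y x
        calc _ ≤ ‖czKernel Ω (x - y)‖ * (C * ‖x - y‖) := by gcongr
          _ = C * (‖czKernel Ω (x - y)‖ * ‖x - y‖ ^ (1 : ℝ)) := by rw [Real.rpow_one]; ring
          _ ≤ C * (B * ‖x - y‖ ^ ((1 : ℝ) - n)) :=
            mul_le_mul_of_nonneg_left (norm_czKernel_mul_rpow_le hB hn 1 _) C.coe_nonneg
          _ = _ := by ring
      · have h1 : c y = 0 := Set.indicator_of_notMem (by exact hy) _
        simp only [Pi.add_apply]
        rw [h1, Set.indicator_of_notMem (by exact hy), sub_zero, mul_zero, zero_add]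
        gcongr
        simpa using norm_czKernel_le hB one_pos (not_le.1 hy).le
  refine ⟨_, (tendsto_setIntegral_lt_norm_sub hn hφ x).congr' ?_⟩
  filter_upwards [self_mem_nhdsWithin] with ε (hε : 0 < ε)
  have hSε := measurableSet_lt_norm_sub x ε
  have hint := integrableOn_czKernel_mul hΩ hf x hε
  have hKc : IntegrableOn (fun y => czKernel Ω (x - y) * c y) {y | ε < ‖x - y‖} := by
    refine (hint.sub hφ.integrableOn).congr (ae_of_all _ fun y => ?_)
    simp only [Pi.sub_apply]
    ring
  have hzero : ∫ y in {y | ε < ‖x - y‖}, czKernel Ω (x - y) * c y = 0 := by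
    have h := hΩ.integral_annulus ε
    rw [← integral_sub_left_eq_self _ _ x] at h
    rw [← integral_indicator hSε]
    calc _ = ∫ y, {x : 𝔼 n | ε < ‖x‖ ∧ ‖x‖ ≤ 1}.indicator (czKernel Ω) (x - y) * f x := by
          refine integral_congr_ae (ae_of_all _ fun y => ?_)
          simp only [hc, Set.indicator_apply, Set.mem_ofPred_eq]
          by_cases h1 : ε < ‖x - y‖ <;> by_cases h2 : ‖x - y‖ ≤ 1 <;> simp [h1, h2]
      _ = 0 := by rw [integral_mul_const, h, zero_mul]
  calc _ = ∫ y in {y | ε < ‖x - y‖}, (czKernel Ω (x - y) * f y - czKernel Ω (x - y) * c y) := by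
        simp_rw [mul_sub]
    _ = _ := by rw [integral_sub hint hKc, hzero, sub_zero]

end CZKernel

/-! ### The upper bound for Hölder symbols -/

section Commutator

variable {n : ℕ} {Ω : EuclideanSpace ℝ (Fin n) → ℂ}

local notation "𝔼" n:max => EuclideanSpace ℝ (Fin n)

/-- The commutator with a Hölder continuous symbol `g`, as an absolutely convergent integral. -/
noncomputable def commutatorIntegral (Ω g f : 𝔼 n → ℂ) (x : 𝔼 n) : ℂ :=
  ∫ y, czKernel Ω (x - y) * (g x - g y) * f y

theorem enorm_commutator_kernel_le {B C α : ℝ} (hB : ∀ x, ‖Ω x‖ ≤ B) (hn : 0 < n) (hC : 0 ≤ C)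
    {g : 𝔼 n → ℂ} (hg : ∀ x y, ‖g x - g y‖ ≤ C * ‖x - y‖ ^ α) (f : 𝔼 n → ℂ) (x y : 𝔼 n) :
    ‖czKernel Ω (x - y) * (g x - g y) * f y‖ₑ ≤
      ENNReal.ofReal (B * C) * (rieszKernel (𝔼 n) α (x - y) * ‖f y‖ₑ) := by
  have hB0 : 0 ≤ B := (norm_nonneg _).trans (hB 0)
  rw [enorm_mul, ← mul_assoc]
  gcongr
  rw [rieszKernel, ← ENNReal.ofReal_mul (by positivity), ← ofReal_norm, norm_mul,
    finrank_euclideanSpace_fin]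
  refine ENNReal.ofReal_le_ofReal ?_
  calc _ ≤ ‖czKernel Ω (x - y)‖ * (C * ‖x - y‖ ^ α) := by gcongr; exact hg x y
    _ = C * (‖czKernel Ω (x - y)‖ * ‖x - y‖ ^ α) := by ring
    _ ≤ C * (B * ‖x - y‖ ^ (α - n)) :=
      mul_le_mul_of_nonneg_left (norm_czKernel_mul_rpow_le hB hn α _) hC
    _ = _ := by ring

theorem measurable_of_norm_sub_le {C α : ℝ} (hα : 0 < α) {g : 𝔼 n → ℂ}
    (hg : ∀ x y, ‖g x - g y‖ ≤ C * ‖x - y‖ ^ α) : Measurable g := by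
  refine Continuous.measurable (continuous_iff_continuousAt.2 fun y => ?_)
  rw [ContinuousAt, tendsto_iff_norm_sub_tendsto_zero]
  refine squeeze_zero (fun _ => norm_nonneg _) (fun x => hg x y) ?_
  have : Continuous fun x : 𝔼 n => C * ‖x - y‖ ^ α :=
    continuous_const.mul ((continuous_id.sub continuous_const).norm.rpow_const fun _ => Or.inr hα.le)
  have h := this.tendsto y
  simpa [Real.zero_rpow hα.ne'] using h

theorem aestronglyMeasurable_commutator_integrand (hΩ : IsCZAngular Ω) {g f : 𝔼 n → ℂ}
    (hg : Measurable g) (hf : AEStronglyMeasurable f) :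
    AEStronglyMeasurable (fun z : 𝔼 n × 𝔼 n => czKernel Ω (z.1 - z.2) * (g z.1 - g z.2) * f z.2)
      (volume.prod volume) := by
  have h1 : Measurable fun z : 𝔼 n × 𝔼 n => czKernel Ω (z.1 - z.2) * (g z.1 - g z.2) :=
    (hΩ.measurable_czKernel.comp (by fun_prop)).mul
      ((hg.comp measurable_fst).sub (hg.comp measurable_snd))
  exact h1.aestronglyMeasurable.mul hf.comp_snd

theorem aestronglyMeasurable_commutatorIntegral (hΩ : IsCZAngular Ω) {g f : 𝔼 n → ℂ}
    (hg : Measurable g) (hf : AEStronglyMeasurable f) :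
    AEStronglyMeasurable (commutatorIntegral Ω g f) :=
  (aestronglyMeasurable_commutator_integrand hΩ hg hf).integral_prod_right'

/-- Pointwise domination by the Riesz potential of |f|, then Hardy-Littlewood-Sobolev. Finiteness of
the potential almost everywhere also gives absolute convergence, without which the commutator
integral need not be additive in f. -/
theorem exists_eLpNorm_commutatorIntegral_le (hΩ : IsCZAngular Ω) {α p q C : ℝ} (hα : 0 < α)
    (hp : 1 < p) (hpq : 1 / q = 1 / p - α / n) (hq : 0 < q) (hC : 0 ≤ C) {g : 𝔼 n → ℂ}
    (hg : ∀ x y, ‖g x - g y‖ ≤ C * ‖x - y‖ ^ α) :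
    ∃ D : NNReal, ∀ f : 𝔼 n → ℂ, MemLp f (ENNReal.ofReal p) →
      (∀ᵐ x, Integrable fun y => czKernel Ω (x - y) * (g x - g y) * f y) ∧
      eLpNorm (commutatorIntegral Ω g f) (ENNReal.ofReal q) ≤
        D * eLpNorm f (ENNReal.ofReal p) := by
  have hn := hΩ.dim_pos
  have : Nontrivial (𝔼 n) := by
    have : Nonempty (Fin n) := ⟨⟨0, hn⟩⟩
    infer_instance
  have hp0 : 0 < p := by linarith
  obtain ⟨B, hB0, hB⟩ := hΩ.exists_norm_le
  obtain ⟨D, hD⟩ := exists_lintegral_rieszPotential_rpow_le (E := 𝔼 n) volume hα hp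
    (by rwa [finrank_euclideanSpace_fin]) hq
  have eL : ∀ {r : ℝ} (_ : 0 < r) (h : 𝔼 n → ℂ), eLpNorm h (ENNReal.ofReal r) =
      (∫⁻ x, ‖h x‖ₑ ^ r) ^ (1 / r) := fun hr h => by
    rw [eLpNorm_eq_lintegral_rpow_enorm_toReal (by simpa using hr) ENNReal.ofReal_ne_top,
      ENNReal.toReal_ofReal hr.le]
  refine ⟨(B * C).toNNReal * D, fun f hf => ?_⟩
  have hfm : AEMeasurable (fun y => ‖f y‖ₑ) := hf.aestronglyMeasurable.enorm
  have hfin : ∫⁻ y, ‖f y‖ₑ ^ p ≠ ⊤ := by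
    have := hf.2
    rw [eL hp0] at this
    exact (ENNReal.rpow_lt_top_iff_of_pos (by positivity) |>.1 this).ne
  have hbd := hD _ hfm hfin
  set I := rieszPotential volume α (fun y => ‖f y‖ₑ) with hI
  have hIm : AEMeasurable I := by
    have e : I = rieszPotential volume α (hfm.mk _) := by
      ext x
      refine lintegral_congr_ae ?_
      filter_upwards [hfm.ae_eq_mk] with y hy
      rw [hy]
    rw [e]
    exact (measurable_rieszPotential _ _ hfm.measurable_mk).aemeasurable
  have hle : ∀ x, ∫⁻ y, ‖czKernel Ω (x - y) * (g x - g y) * f y‖ₑ ≤ ENNReal.ofReal (B * C) * I x := by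
    intro x
    rw [hI, rieszPotential, ← lintegral_const_mul' _ _ ENNReal.ofReal_ne_top]
    exact lintegral_mono fun y => enorm_commutator_kernel_le hB hn hC hg f x y
  constructor
  · have hIfin : ∀ᵐ x, I x ^ q < ⊤ := by
      refine ae_lt_top' (hIm.pow_const q) ?_
      have h1 : (D : ENNReal) * (∫⁻ y, ‖f y‖ₑ ^ p) ^ (1 / p) < ⊤ :=
        ENNReal.mul_lt_top ENNReal.coe_lt_top
          (ENNReal.rpow_lt_top_of_nonneg (by positivity) hfin)
      exact (ENNReal.rpow_lt_top_iff_of_pos (by positivity) |>.1 (hbd.trans_lt h1)).ne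
    filter_upwards [hIfin, (aestronglyMeasurable_commutator_integrand hΩ
      (measurable_of_norm_sub_le hα hg) hf.aestronglyMeasurable).prodMk_left] with x hx hxm
    refine ⟨hxm, (hle x).trans_lt ?_⟩
    exact ENNReal.mul_lt_top ENNReal.ofReal_lt_top
      ((ENNReal.rpow_lt_top_iff_of_pos hq).1 hx)
  · rw [eL hq, eL hp0]
    calc _ ≤ (∫⁻ x, (ENNReal.ofReal (B * C) * I x) ^ q) ^ (1 / q) := by
          gcongr with x
          exact (enorm_integral_le_lintegral_enorm _).trans (hle x)
      _ = ENNReal.ofReal (B * C) * (∫⁻ x, I x ^ q) ^ (1 / q) := by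
          simp_rw [ENNReal.mul_rpow_of_nonneg _ _ hq.le]
          rw [lintegral_const_mul' _ _
            (ENNReal.rpow_ne_top_of_nonneg hq.le ENNReal.ofReal_ne_top),
            ENNReal.mul_rpow_of_nonneg _ _ (by positivity), ← ENNReal.rpow_mul,
            mul_one_div_cancel hq.ne', ENNReal.rpow_one]
      _ ≤ ENNReal.ofReal (B * C) * (D * (∫⁻ y, ‖f y‖ₑ ^ p) ^ (1 / p)) := by gcongr
      _ = _ := by
          rw [← mul_assoc, ENNReal.coe_mul]
          rfl

theorem commutatorIntegral_congr (Ω g : 𝔼 n → ℂ) {f f' : 𝔼 n → ℂ} (h : f =ᵐ[volume] f') (x : 𝔼 n) :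
    commutatorIntegral Ω g f x = commutatorIntegral Ω g f' x := by
  refine integral_congr_ae ?_
  filter_upwards [h] with y hy
  rw [hy]

/-- The commutator integral agrees with the principal value commutator on nice functions. -/
theorem hasCommutator_of_integrable (hΩ : IsCZAngular Ω) {b g f : 𝔼 n → ℂ} (hbg : b =ᵐ[volume] g)
    (hf : Integrable f) {C : NNReal} (hC : LipschitzWith C f) {x : 𝔼 n} (hx : b x = g x)
    (hint : Integrable fun y => czKernel Ω (x - y) * (g x - g y) * f y) :
    HasCommutator Ω b f x (commutatorIntegral Ω g f x) := by
  obtain ⟨u, hu⟩ := exists_hasSingularIntegral hΩ hf hC x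
  refine ⟨u, b x * u - commutatorIntegral Ω g f x, hu, ?_, by ring⟩
  -- At each ε, the truncation of T(bf) is b(x) times the truncation of Tf minus the truncated
  -- commutator integral. Both of these converge, so T(bf)(x) exists.
  refine ((hu.const_mul (b x)).sub (tendsto_setIntegral_lt_norm_sub hΩ.dim_pos hint x)).congr' ?_
  filter_upwards [self_mem_nhdsWithin] with ε (hε : 0 < ε)
  rw [← integral_const_mul, ← integral_sub ((integrableOn_czKernel_mul hΩ hf x hε).const_mul _)
    hint.integrableOn]
  refine integral_congr_ae (ae_restrict_of_ae ?_)
  filter_upwards [hbg] with y hy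
  rw [hx, hy]
  ring

/-- Commutators with Hölder continuous symbols are bounded from `L^p` to `L^q`. -/
theorem commutatorBounded_of_isLip (hΩ : IsCZAngular Ω) {α p q : ℝ} (hα : 0 < α) (hp : 1 < p)
    (hpq : 1 / q = 1 / p - α / n) (hq : 0 < q) {b : 𝔼 n → ℂ} (hb : IsLip α b) :
    CommutatorBounded Ω b p (fun g => eLpNorm g (ENNReal.ofReal q) volume) := by
  obtain ⟨g, hbg, C₀, hC₀⟩ := hb
  obtain ⟨C, hC0, hg⟩ : ∃ C : ℝ, 0 ≤ C ∧ ∀ x y, ‖g x - g y‖ ≤ C * ‖x - y‖ ^ α := by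
    refine ⟨max C₀ 0, le_max_right _ _, fun x y => ?_⟩
    by_cases hxy : x = y
    · subst hxy
      simp only [sub_self, norm_zero]
      positivity
    · have hpos : 0 < ‖x - y‖ := norm_pos_iff.2 (sub_ne_zero.2 hxy)
      have h := (hC₀ y (x - y) (sub_ne_zero.2 hxy)).trans (le_max_left C₀ 0)
      rwa [add_sub_cancel, div_le_iff₀ (by positivity)] at h
  have hgm := measurable_of_norm_sub_le hα hg
  obtain ⟨D, hD⟩ := exists_eLpNorm_commutatorIntegral_le hΩ hα hp hpq hq hC0 hg
  have hm : ∀ F : Lp ℂ (ENNReal.ofReal p) (volume : Measure (𝔼 n)),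
      AEStronglyMeasurable (commutatorIntegral Ω g F) := fun F =>
    aestronglyMeasurable_commutatorIntegral hΩ hgm (Lp.aestronglyMeasurable F)
  refine ⟨{ toFun := fun F => AEEqFun.mk _ (hm F), map_add' := ?_, map_smul' := ?_ },
    ⟨D, fun F => ?_⟩, ?_⟩
  · intro F G
    rw [AEEqFun.mk_add_mk, AEEqFun.mk_eq_mk]
    filter_upwards [(hD F (Lp.memLp F)).1, (hD G (Lp.memLp G)).1] with x h1 h2
    rw [commutatorIntegral_congr Ω g (Lp.coeFn_add F G) x, Pi.add_apply]
    unfold commutatorIntegral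
    rw [← integral_add h1 h2]
    simp only [Pi.add_apply, mul_add]
  · intro c F
    rw [RingHom.id_apply, AEEqFun.smul_mk, AEEqFun.mk_eq_mk]
    refine ae_of_all _ fun x => ?_
    rw [commutatorIntegral_congr Ω g (Lp.coeFn_smul c F) x, Pi.smul_apply]
    unfold commutatorIntegral
    rw [← integral_smul]
    simp only [Pi.smul_apply, smul_eq_mul]
    congr 1
    ext y
    ring
  · simp only [LinearMap.coe_mk, AddHom.coe_mk]
    rw [eLpNorm_congr_ae (AEEqFun.coeFn_mk _ _)]
    exact (hD F (Lp.memLp F)).2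
  · intro f hf hfs F hF
    obtain ⟨L, hL⟩ := ContDiff.lipschitzWith_of_hasCompactSupport hfs hf (by simp)
    have hfi : Integrable f := hf.continuous.integrable_of_hasCompactSupport hfs
    filter_upwards [hbg, (hD F (Lp.memLp F)).1, AEEqFun.coeFn_mk _ (hm F)] with x hx hint hAx
    simp only [LinearMap.coe_mk, AddHom.coe_mk]
    rw [hAx, commutatorIntegral_congr Ω g hF x]
    refine hasCommutator_of_integrable hΩ hbg hfi hL hx (hint.congr ?_)
    filter_upwards [hF] with y hy
    rw [hy]

/-- The weak `L^q` quasi-norm is at most the `L^q` norm. -/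
theorem weakLpNorm_le_eLpNorm {q : ℝ} (hq : 0 < q) {f : 𝔼 n → ℂ} (hf : AEStronglyMeasurable f) :
    weakLpNorm q f ≤ eLpNorm f (ENNReal.ofReal q) := by
  refine iSup₂_le fun t ht => ?_
  have h := mul_meas_ge_le_pow_eLpNorm' volume (by simpa using hq) ENNReal.ofReal_ne_top hf
    (ENNReal.ofReal t)
  rw [ENNReal.toReal_ofReal hq.le] at h
  calc _ ≤ ENNReal.ofReal t * volume {x | ENNReal.ofReal t ≤ ‖f x‖ₑ} ^ (1 / q) := by
        gcongr with x
        intro hx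
        rw [← ofReal_norm]
        exact ENNReal.ofReal_le_ofReal hx.le
    _ = (ENNReal.ofReal t ^ q * volume {x | ENNReal.ofReal t ≤ ‖f x‖ₑ}) ^ (1 / q) := by
        rw [ENNReal.mul_rpow_of_nonneg _ _ (by positivity), ← ENNReal.rpow_mul,
          mul_one_div_cancel hq.ne', ENNReal.rpow_one]
    _ ≤ (eLpNorm f (ENNReal.ofReal q) ^ q) ^ (1 / q) := by gcongr
    _ = _ := by rw [← ENNReal.rpow_mul, mul_one_div_cancel hq.ne', ENNReal.rpow_one]

theorem CommutatorBounded.weak {p q : ℝ} (hq : 0 < q) {b : 𝔼 n → ℂ}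
    (h : CommutatorBounded Ω b p (fun g => eLpNorm g (ENNReal.ofReal q) volume)) :
    CommutatorBounded Ω b p (weakLpNorm q) := by
  obtain ⟨A, ⟨C, hC⟩, hA⟩ := h
  exact ⟨A, ⟨C, fun F => (weakLpNorm_le_eLpNorm hq (A F).aestronglyMeasurable).trans (hC F)⟩, hA⟩

end Commutator

/-! ### Campanato's characterization of Hölder continuity -/

section Campanato

variable {E : Type*} [NormedAddCommGroup E] [NormedSpace ℝ E] [FiniteDimensional ℝ E]
  [MeasurableSpace E] [BorelSpace E] {F : Type*} [NormedAddCommGroup F] [NormedSpace ℝ F]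
  {μ : Measure E} [μ.IsAddHaarMeasure]

/-- The left side is the norm of the average of b - c over S, and enlarging S to T only increases
the integral of |b - c|. The constant c may thus be adapted to the larger set. -/
theorem norm_setAverage_sub_le {α : Type*} [MeasurableSpace α] {ν : Measure α} [CompleteSpace F]
    {S T : Set α} {b : α → F} {c : F} {K : ℝ} (hST : S ⊆ T) (hS0 : ν S ≠ 0) (hS : ν S ≠ ⊤)
    (hb : IntegrableOn b S ν) (hK : 0 ≤ K) (h : ∫⁻ x in T, ‖b x - c‖ₑ ∂ν ≤ ENNReal.ofReal K) :
    ‖(⨍ x in S, b x ∂ν) - c‖ ≤ K / ν.real S := by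
  have hpos : 0 < ν.real S := ENNReal.toReal_pos hS0 hS
  have e : (⨍ x in S, b x ∂ν) - c = (ν.real S)⁻¹ • ∫ x in S, (b x - c) ∂ν := by
    have : IsFiniteMeasure (ν.restrict S) := ⟨by simpa using hS.lt_top⟩
    rw [integral_sub hb (integrable_const c), setIntegral_const, smul_sub, smul_smul,
      inv_mul_cancel₀ hpos.ne', one_smul, setAverage_eq]
  rw [e, norm_smul, norm_inv, Real.norm_of_nonneg hpos.le, inv_mul_eq_div]
  gcongr
  have h1 : ‖∫ x in S, (b x - c) ∂ν‖ₑ ≤ ENNReal.ofReal K :=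
    (enorm_integral_le_lintegral_enorm _).trans ((lintegral_mono_set hST).trans h)
  rw [← ofReal_norm] at h1
  exact (ENNReal.ofReal_le_ofReal_iff hK).1 h1

/-- Averages over comparable nested balls of a function with small mean oscillation. -/
theorem exists_norm_setAverage_sub_setAverage_le [CompleteSpace F] {b : E → F}
    (hb : LocallyIntegrable b μ) {α M : ℝ} (hM : 0 ≤ M)
    (hosc : ∀ x : E, ∀ r : ℝ, 0 < r → ∃ c : F, ∫⁻ y in Metric.closedBall x r, ‖b y - c‖ₑ ∂μ ≤
      ENNReal.ofReal (M * r ^ (Module.finrank ℝ E + α))) :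
    ∃ C : ℝ, 0 ≤ C ∧ ∀ x y : E, ∀ r s : ℝ, 0 < r → r / 2 ≤ s →
      Metric.closedBall x s ⊆ Metric.closedBall y r →
      ‖(⨍ z in Metric.closedBall x s, b z ∂μ) - ⨍ z in Metric.closedBall y r, b z ∂μ‖ ≤
        C * r ^ α := by
  set d := Module.finrank ℝ E with hd
  set v := μ.real (Metric.ball (0 : E) 1) with hv
  have hv0 : 0 < v :=
    ENNReal.toReal_pos (Metric.measure_ball_pos μ _ one_pos).ne' measure_ball_lt_top.ne
  have hvol : ∀ (x : E) (r : ℝ), 0 < r → μ.real (Metric.closedBall x r) = r ^ d * v := by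
    intro x r hr
    rw [Measure.real, Measure.addHaar_closedBall μ x hr.le, ENNReal.toReal_mul,
      ENNReal.toReal_ofReal (by positivity)]
    rfl
  have key : ∀ x y : E, ∀ r s : ℝ, ∀ c : F, 0 < r → r / 2 ≤ s →
      Metric.closedBall x s ⊆ Metric.closedBall y r →
      ∫⁻ y in Metric.closedBall y r, ‖b y - c‖ₑ ∂μ ≤ ENNReal.ofReal (M * r ^ (d + α)) →
      ‖(⨍ z in Metric.closedBall x s, b z ∂μ) - c‖ ≤ 2 ^ d * M / v * r ^ α := by
    intro x y r s c hr hs hsub hc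
    have hs0 : 0 < s := by linarith
    refine (norm_setAverage_sub_le hsub (Metric.measure_closedBall_pos μ _ hs0).ne'
      measure_closedBall_lt_top.ne (hb.integrableOn_isCompact (isCompact_closedBall _ _))
      (by positivity) hc).trans ?_
    rw [hvol x s hs0]
    calc M * r ^ (d + α) / (s ^ d * v) ≤ M * r ^ (d + α) / ((r / 2) ^ d * v) := by gcongr
      _ = _ := by
        rw [Real.rpow_add hr, Real.rpow_natCast, div_pow]
        field_simp
  -- The 2 comes from comparing both averages with the same c, and 2^d from the volume ratio of
  -- balls of radii r and s ≥ r/2.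
  refine ⟨2 * (2 ^ d * M / v), by positivity, fun x y r s hr hs hsub => ?_⟩
  obtain ⟨c, hc⟩ := hosc y r hr
  have h1 := key x y r s c hr hs hsub hc
  have h2 := key y y r r c hr (by linarith) subset_rfl hc
  calc _ = ‖((⨍ z in Metric.closedBall x s, b z ∂μ) - c) -
        ((⨍ z in Metric.closedBall y r, b z ∂μ) - c)‖ := by rw [sub_sub_sub_cancel_right]
    _ ≤ _ := norm_sub_le _ _
    _ ≤ _ := by linarith

/-- **Campanato's theorem**: a function whose mean oscillation on balls of radius `r` is
`O(r ^ α)` agrees almost everywhere with a Hölder continuous function. -/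
theorem exists_holder_of_mean_oscillation [CompleteSpace F] {b : E → F}
    (hb : LocallyIntegrable b μ) {α M : ℝ} (hα : 0 < α) (hM : 0 ≤ M)
    (hosc : ∀ x : E, ∀ r : ℝ, 0 < r → ∃ c : F, ∫⁻ y in Metric.closedBall x r, ‖b y - c‖ₑ ∂μ ≤
      ENNReal.ofReal (M * r ^ (Module.finrank ℝ E + α))) :
    ∃ g : E → F, b =ᵐ[μ] g ∧ ∃ C : ℝ, ∀ x h : E, h ≠ 0 → ‖g (x + h) - g x‖ ≤ C * ‖h‖ ^ α := by
  obtain ⟨C, hC0, hC⟩ := exists_norm_setAverage_sub_setAverage_le hb hM hosc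
  set u : E → ℝ → F := fun x r => ⨍ z in Metric.closedBall x r, b z ∂μ with hu
  have hlt : (1 / 2 : ℝ) ^ α < 1 := Real.rpow_lt_one (by norm_num) (by norm_num) hα
  -- The sum of the geometric series of errors C 2^(-αj) over successive halvings of the radius. The
  -- identity B 2^(-α) + C = B closes the induction below, which is on the number of halvings
  -- between r and s.
  set B : ℝ := C / (1 - (1 / 2) ^ α) with hB
  have hB0 : 0 ≤ B := div_nonneg hC0 (by linarith)
  have hBC : B * (1 / 2) ^ α + C = B := by
    have : 1 - (1 / 2 : ℝ) ^ α ≠ 0 := by linarith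
    rw [hB]
    field_simp
    ring
  have hstep : ∀ x : E, ∀ k : ℕ, ∀ r s : ℝ, 0 < r → r * (1 / 2) ^ k ≤ s → s ≤ r →
      ‖u x s - u x r‖ ≤ B * r ^ α := by
    intro x k
    induction k with
    | zero =>
      intro r s hr h1 h2
      obtain rfl : s = r := by linarith
      simp only [sub_self, norm_zero]
      positivity
    | succ k ih =>
      intro r s hr h1 h2
      rcases le_total (r / 2) s with h | h
      · refine (hC x x r s hr h (Metric.closedBall_subset_closedBall h2)).trans ?_
        gcongr
        have : 0 ≤ B * (1 / 2) ^ α := by positivity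
        linarith
      · have h3 := ih (r / 2) s (by positivity) (by rw [pow_succ] at h1; linarith) h
        have h4 := hC x x r (r / 2) hr le_rfl (Metric.closedBall_subset_closedBall (by linarith))
        calc ‖u x s - u x r‖ ≤ ‖u x s - u x (r / 2)‖ + ‖u x (r / 2) - u x r‖ :=
              norm_sub_le_norm_sub_add_norm_sub _ _ _
          _ ≤ B * (r / 2) ^ α + C * r ^ α := add_le_add h3 h4
          _ = (B * (1 / 2) ^ α + C) * r ^ α := by
              rw [div_eq_mul_one_div, Real.mul_rpow hr.le (by norm_num)]
              ring
          _ = B * r ^ α := by rw [hBC]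
  have hu1 : ∀ x : E, ∀ r s : ℝ, 0 < s → s ≤ r → ‖u x s - u x r‖ ≤ B * r ^ α := by
    intro x r s hs hsr
    have hr : 0 < r := by linarith
    obtain ⟨k, hk⟩ := exists_pow_lt_of_lt_one (div_pos hs hr) (by norm_num : (1 / 2 : ℝ) < 1)
    refine hstep x k r s hr ?_ hsr
    rw [lt_div_iff₀ hr] at hk
    linarith
  have hpos : ∀ k : ℕ, (0 : ℝ) < (1 / 2) ^ k := fun k => by positivity
  have h0 : Tendsto (fun k : ℕ => (1 / 2 : ℝ) ^ k) atTop (𝓝 0) :=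
    tendsto_pow_atTop_nhds_zero_of_lt_one (by norm_num) (by norm_num)
  have hlim : ∀ x : E, ∃ y : F, Tendsto (fun k : ℕ => u x ((1 / 2) ^ k)) atTop (𝓝 y) := by
    intro x
    refine cauchySeq_tendsto_of_complete
      (cauchySeq_of_le_tendsto_0 (fun k : ℕ => 2 * (B * ((1 / 2) ^ k) ^ α)) ?_ ?_)
    · intro i j N hi hj
      have hi' := hu1 x _ _ (hpos i)
        (pow_le_pow_of_le_one (by norm_num) (by norm_num) hi : (1 / 2 : ℝ) ^ i ≤ (1 / 2) ^ N)
      have hj' := hu1 x _ _ (hpos j)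
        (pow_le_pow_of_le_one (by norm_num) (by norm_num) hj : (1 / 2 : ℝ) ^ j ≤ (1 / 2) ^ N)
      rw [dist_eq_norm]
      calc _ ≤ ‖u x ((1 / 2) ^ i) - u x ((1 / 2) ^ N)‖ + ‖u x ((1 / 2) ^ N) - u x ((1 / 2) ^ j)‖ :=
            norm_sub_le_norm_sub_add_norm_sub _ _ _
        _ ≤ _ := by
            rw [norm_sub_rev (u x ((1 / 2) ^ N))]
            linarith
    · have h := ((h0.rpow_const (Or.inr hα.le) (p := α)).const_mul B).const_mul 2
      simpa [Real.zero_rpow hα.ne'] using h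
  choose g hg using hlim
  have hgu : ∀ x : E, ∀ r : ℝ, 0 < r → ‖g x - u x r‖ ≤ B * r ^ α := by
    intro x r hr
    refine le_of_tendsto ((hg x).sub_const (u x r)).norm ?_
    filter_upwards [h0.eventually (gt_mem_nhds hr)] with k hk
    exact hu1 x r _ (hpos k) (le_of_lt hk)
  refine ⟨g, ?_, (B + C + B) * 2 ^ α, fun x h hh => ?_⟩
  -- Lebesgue differentiation: almost everywhere the averages that define g converge to b.
  · filter_upwards [IsUnifLocDoublingMeasure.ae_tendsto_average μ hb 1] with x hx
    have h1 := hx (fun _ => x) (fun k : ℕ => (1 / 2 : ℝ) ^ k)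
      (tendsto_nhdsWithin_iff.2 ⟨h0, Eventually.of_forall hpos⟩)
      (Eventually.of_forall fun k => Metric.mem_closedBall_self (by simp))
    exact tendsto_nhds_unique h1 (hg x)
  · have hh' : 0 < ‖h‖ := norm_pos_iff.2 hh
    -- The ball of radius 2|h| about x + h contains the ball of radius |h| about x, so the averages
    -- over the two are comparable.
    have h1 := hgu (x + h) (2 * ‖h‖) (by positivity)
    have h2 := hC x (x + h) (2 * ‖h‖) ‖h‖ (by positivity) (by linarith)
      (Metric.closedBall_subset_closedBall' (by rw [dist_eq_norm]; simp; linarith))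
    have h3 := hgu x ‖h‖ hh'
    have h4 : B * ‖h‖ ^ α ≤ B * (2 * ‖h‖) ^ α := by gcongr; linarith
    rw [norm_sub_rev] at h2 h3
    calc ‖g (x + h) - g x‖
        ≤ ‖g (x + h) - u (x + h) (2 * ‖h‖)‖ + ‖u (x + h) (2 * ‖h‖) - u x ‖h‖‖
            + ‖u x ‖h‖ - g x‖ := by
          refine (norm_sub_le_norm_sub_add_norm_sub _ (u x ‖h‖) _).trans ?_
          gcongr
          exact norm_sub_le_norm_sub_add_norm_sub _ _ _
      _ ≤ B * (2 * ‖h‖) ^ α + C * (2 * ‖h‖) ^ α + B * (2 * ‖h‖) ^ α := by linarith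
      _ = _ := by
          rw [Real.mul_rpow (by norm_num) hh'.le]
          ring

end Campanato

/-! ### Local integrability of weak L^q functions -/

section WeakLp

variable {n : ℕ}

local notation "𝔼" n:max => EuclideanSpace ℝ (Fin n)

/-- Functions in weak `L^q`, `q > 1`, are integrable over sets of finite measure. -/
theorem setLIntegral_enorm_le_of_weakLpNorm_le {q N : ℝ} (hq : 1 < q) (hN : 0 < N) {f : 𝔼 n → ℂ}
    (hf : AEStronglyMeasurable f) (h : weakLpNorm q f ≤ ENNReal.ofReal N) {S : Set (𝔼 n)} {V : ℝ}
    (hV : 0 < V) (hS : volume S = ENNReal.ofReal V) :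
    ∫⁻ x in S, ‖f x‖ₑ ≤ ENNReal.ofReal (q / (q - 1) * N * V ^ (1 - 1 / q)) := by
  have hq0 : 0 < q := by linarith
  have hq1 : 0 < q - 1 := by linarith
  -- The level at which the two bounds V and N^q t^(-q) for the measure of {|f| > t} inside S
  -- coincide.
  set T : ℝ := N * V ^ (-(1 / q)) with hT
  have hT0 : 0 < T := by positivity
  have hlev : ∀ t : ℝ, 0 < t → volume.restrict S {x | t < ‖f x‖} ≤
      ENNReal.ofReal (N ^ q * t ^ (-q)) := by
    intro t ht
    have h1 : ENNReal.ofReal t * volume {x | t < ‖f x‖} ^ (1 / q) ≤ ENNReal.ofReal N :=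
      (le_iSup₂ (f := fun (t : ℝ) (_ : 0 < t) =>
        ENNReal.ofReal t * volume {x | t < ‖f x‖} ^ (1 / q)) t ht).trans h
    have h2 : volume {x | t < ‖f x‖} ^ (1 / q) ≤ ENNReal.ofReal (N / t) := by
      rw [ENNReal.ofReal_div_of_pos ht, ENNReal.le_div_iff_mul_le (by simp [ht]) (by simp), mul_comm]
      exact h1
    rw [one_div, ENNReal.rpow_inv_le_iff hq0,
      ENNReal.ofReal_rpow_of_nonneg (by positivity) hq0.le, Real.div_rpow hN.le ht.le] at h2
    rw [Real.rpow_neg ht.le, ← div_eq_mul_inv]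
    exact (Measure.restrict_apply_le S _).trans h2
  have hbig : ∀ t : ℝ, volume.restrict S {x | t < ‖f x‖} ≤ ENNReal.ofReal V := by
    intro t
    rw [← hS, ← Measure.restrict_apply_univ S]
    exact measure_mono (Set.subset_univ _)
  have hlin : ∫⁻ t in Set.Ioi T, ENNReal.ofReal (N ^ q * t ^ (-q)) =
      ENNReal.ofReal (N ^ q * (T ^ (1 - q) / (q - 1))) := by
    rw [← ofReal_integral_eq_lintegral_ofReal
      ((integrableOn_Ioi_rpow_of_lt (by linarith) hT0).const_mul _), integral_const_mul,
      integral_Ioi_rpow_of_lt (by linarith) hT0]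
    · congr 2
      rw [neg_div, ← div_neg]
      ring_nf
    · filter_upwards [ae_restrict_mem measurableSet_Ioi] with t ht
      have : 0 < t := hT0.trans ht
      positivity
  calc ∫⁻ x in S, ‖f x‖ₑ = ∫⁻ x in S, ENNReal.ofReal ‖f x‖ := by simp_rw [ofReal_norm]
    _ = ∫⁻ t in Set.Ioi 0, volume.restrict S {x | t < ‖f x‖} :=
        lintegral_eq_lintegral_meas_lt _ (ae_of_all _ fun x => norm_nonneg _)
          hf.norm.aemeasurable.restrict
    _ = ∫⁻ t in Set.Ioc 0 T ∪ Set.Ioi T, volume.restrict S {x | t < ‖f x‖} := by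
        rw [Set.Ioc_union_Ioi_eq_Ioi hT0.le]
    _ ≤ (∫⁻ t in Set.Ioc 0 T, volume.restrict S {x | t < ‖f x‖}) +
          ∫⁻ t in Set.Ioi T, volume.restrict S {x | t < ‖f x‖} := lintegral_union_le _ _ _
    _ ≤ (∫⁻ t in Set.Ioc 0 T, ENNReal.ofReal V) +
          ∫⁻ t in Set.Ioi T, ENNReal.ofReal (N ^ q * t ^ (-q)) := by
        refine add_le_add (lintegral_mono hbig) ?_
        exact setLIntegral_mono_ae' measurableSet_Ioi
          (ae_of_all _ fun t ht => hlev t (hT0.trans ht))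
    _ = ENNReal.ofReal (V * T + N ^ q * (T ^ (1 - q) / (q - 1))) := by
        rw [hlin, setLIntegral_const, Real.volume_Ioc, sub_zero, ← ENNReal.ofReal_mul hV.le,
          ← ENNReal.ofReal_add (by positivity) (by positivity)]
    _ = _ := by
        congr 1
        have h1 : V * T = N * V ^ (1 - 1 / q) := by
          rw [hT, sub_eq_add_neg, Real.rpow_add hV, Real.rpow_one]
          ring
        have h2 : N ^ q * T ^ (1 - q) = N * V ^ (1 - 1 / q) := by
          rw [hT, Real.mul_rpow hN.le (by positivity), ← mul_assoc, ← Real.rpow_add hN,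
            add_sub_cancel, Real.rpow_one, ← Real.rpow_mul hV.le]
          congr 2
          field_simp
          ring
        rw [← mul_div_assoc, h1, h2]
        field_simp
        ring

end WeakLp

/-! ### Testing the commutator where the kernel is nearly constant -/

section LowerBound

variable {n : ℕ} {Ω : EuclideanSpace ℝ (Fin n) → ℂ}

local notation "𝔼" n:max => EuclideanSpace ℝ (Fin n)

theorem IsCZAngular.czKernel_smul (hΩ : IsCZAngular Ω) {t : ℝ} (ht : 0 < t) (x : 𝔼 n) :
    czKernel Ω (t • x) = czKernel Ω x / ((t ^ n : ℝ) : ℂ) := by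
  rw [czKernel, czKernel, hΩ.homogeneous t x ht, norm_smul, Real.norm_of_nonneg ht.le, mul_pow,
    div_div, mul_comm, Complex.ofReal_mul]

theorem IsCZAngular.continuousAt_czKernel (hΩ : IsCZAngular Ω) {x : 𝔼 n} (hx : x ≠ 0) :
    ContinuousAt (czKernel Ω) x := by
  have h1 : ContinuousAt Ω x := hΩ.smooth.continuousOn.continuousAt
    (isOpen_compl_singleton.mem_nhds hx)
  refine h1.div (by fun_prop) ?_
  exact_mod_cast (pow_pos (norm_pos_iff.2 hx) n).ne'

/-- In a suitable direction, the kernel is almost constant at large scale. -/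
theorem IsCZAngular.exists_czKernel_approx (hΩ : IsCZAngular Ω) {δ : ℝ} (hδ : 0 < δ) :
    ∃ (e : 𝔼 n) (k : ℂ), k ≠ 0 ∧ ∀ r : ℝ, 0 < r → ∀ z : 𝔼 n, ‖z - r • e‖ < 3 * r →
      r ≤ ‖z‖ ∧ ‖czKernel Ω z - k / ((r ^ n : ℝ) : ℂ)‖ ≤ δ * ‖k / ((r ^ n : ℝ) : ℂ)‖ := by
  obtain ⟨z₀, hz₀, hΩz⟩ := hΩ.nontrivial
  have hz₀0 : z₀ ≠ 0 := by
    rintro rfl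
    simp at hz₀
  have hK : czKernel Ω z₀ = Ω z₀ := by simp [czKernel, hz₀]
  have hpos : 0 < ‖Ω z₀‖ := norm_pos_iff.2 hΩz
  obtain ⟨η₀, hη₀, hc⟩ := Metric.continuousAt_iff.1 (hΩ.continuousAt_czKernel hz₀0) (δ * ‖Ω z₀‖)
    (by positivity)
  set η := min η₀ 1 with hη
  have hη0 : 0 < η := lt_min hη₀ one_pos
  -- By continuity K varies by at most δ|K(z₀)| on the ball of radius η about z₀. Dilating by ρ =
  -- 4r/η gives a ball of radius 4r > 3r about re, with the same relative error by homogeneity.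
  -- Since η ≤ 1, the center has norm ρ ≥ 4r, which keeps z at distance at least r from the
  -- singularity.
  refine ⟨(4 / η) • z₀, Ω z₀ / (((4 / η) ^ n : ℝ) : ℂ), ?_, fun r hr z hz => ?_⟩
  · exact div_ne_zero hΩz (by exact_mod_cast (by positivity : (0 : ℝ) < (4 / η) ^ n).ne')
  set ρ := r * (4 / η) with hρ
  have hρ0 : 0 < ρ := by positivity
  have hρη : ρ * η = 4 * r := by rw [hρ]; field_simp
  rw [smul_smul, ← hρ] at hz
  have e1 : Ω z₀ / (((4 / η) ^ n : ℝ) : ℂ) / ((r ^ n : ℝ) : ℂ) = Ω z₀ / ((ρ ^ n : ℝ) : ℂ) := by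
    rw [hρ, mul_pow, div_div, mul_comm, Complex.ofReal_mul]
  have e2 : z = ρ • (ρ⁻¹ • z) := by rw [smul_smul, mul_inv_cancel₀ hρ0.ne', one_smul]
  constructor
  · have h1 : ρ = ‖ρ • z₀‖ := by rw [norm_smul, hz₀, mul_one, Real.norm_of_nonneg hρ0.le]
    have h2 : ‖ρ • z₀‖ ≤ ‖z‖ + ‖z - ρ • z₀‖ := by
      rw [norm_sub_rev]
      exact norm_le_norm_add_norm_sub' _ _
    have h3 : 4 * r ≤ ρ := by
      rw [← hρη]
      exact mul_le_of_le_one_right hρ0.le (min_le_right _ _)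
    linarith
  · have h1 : dist (ρ⁻¹ • z) z₀ < η₀ := by
      have : ρ⁻¹ • z - z₀ = ρ⁻¹ • (z - ρ • z₀) := by
        rw [smul_sub, smul_smul, inv_mul_cancel₀ hρ0.ne', one_smul]
      rw [dist_eq_norm, this, norm_smul, norm_inv, Real.norm_of_nonneg hρ0.le, inv_mul_lt_iff₀ hρ0]
      have : ρ * η ≤ ρ * η₀ := by gcongr; exact min_le_left _ _
      linarith
    have h2 := (hc h1).le
    rw [dist_eq_norm, hK] at h2
    have hρn : (0 : ℝ) < ρ ^ n := by positivity
    rw [e1, e2, hΩ.czKernel_smul hρ0, ← sub_div, norm_div, norm_div, Complex.norm_real,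
      Real.norm_of_nonneg hρn.le, ← mul_div_assoc]
    gcongr

/-- Away from the support of f, the truncated integrals do not depend on ε once ε < r. -/
theorem HasSingularIntegral.eq_integral {f : 𝔼 n → ℂ} {x : 𝔼 n} {v : ℂ} {r : ℝ} (hr : 0 < r)
    (hsupp : ∀ y, f y ≠ 0 → r ≤ ‖x - y‖) (h : HasSingularIntegral Ω f x v) :
    v = ∫ y, czKernel Ω (x - y) * f y := by
  refine tendsto_nhds_unique h (tendsto_const_nhds.congr' ?_)
  filter_upwards [Ioo_mem_nhdsGT hr] with ε hε
  refine (setIntegral_eq_integral_of_forall_compl_eq_zero fun y hy => ?_).symm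
  have : f y = 0 := by
    by_contra hy0
    exact hy (hε.2.trans_le (hsupp y hy0))
  rw [this, mul_zero]

/-- Where the kernel is almost a constant `k`, so is the commutator almost
`k (b(x) ∫ f - ∫ b f)`. -/
theorem norm_mul_integral_sub_integral_le (hΩ : IsCZAngular Ω) {b f : 𝔼 n → ℂ} {x : 𝔼 n}
    {v k : ℂ} {r δ : ℝ} (hr : 0 < r) (hk : k ≠ 0) (hf : Integrable f)
    (hbf : Integrable fun y => b y * f y)
    (hsupp : ∀ y, f y ≠ 0 → r ≤ ‖x - y‖ ∧ ‖czKernel Ω (x - y) - k‖ ≤ δ * ‖k‖)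
    (h : HasCommutator Ω b f x v) :
    ‖b x * (∫ y, f y) - ∫ y, b y * f y‖ ≤
      ‖k‖⁻¹ * ‖v‖ + δ * ∫ y, ‖b x - b y‖ * ‖f y‖ := by
  obtain ⟨u, w, hu, hw, rfl⟩ := h
  have hk0 : 0 < ‖k‖ := norm_pos_iff.2 hk
  have hu' := hu.eq_integral hr fun y hy => (hsupp y hy).1
  have hw' := hw.eq_integral hr fun y hy => (hsupp y (right_ne_zero_of_mul hy)).1
  have hKint : ∀ φ : 𝔼 n → ℂ, Integrable φ → (∀ y, φ y ≠ 0 → f y ≠ 0) →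
      Integrable fun y => czKernel Ω (x - y) * φ y := by
    intro φ hφ hφf
    have h1 := integrableOn_czKernel_mul hΩ hφ x (half_pos hr)
    refine (integrableOn_iff_integrable_of_support_subset fun y hy => ?_).1 h1
    have := (hsupp y (hφf y (right_ne_zero_of_mul hy))).1
    exact (half_lt_self hr).trans_le this
  have hKf := hKint f hf fun y hy => hy
  have hKbf := hKint _ hbf fun y hy => right_ne_zero_of_mul hy
  have hd : Integrable fun y => ‖b x - b y‖ * ‖f y‖ := by
    refine ((hf.const_mul (b x)).sub hbf).norm.congr (ae_of_all _ fun y => ?_)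
    simp only [Pi.sub_apply]
    rw [← norm_mul, sub_mul]
  -- Replacing the kernel by the constant k costs exactly this integral, in which the relative error
  -- of the kernel multiplies b(x) - b(y).
  have e : k * (b x * (∫ y, f y) - ∫ y, b y * f y) - (b x * u - w) =
      ∫ y, (k - czKernel Ω (x - y)) * ((b x - b y) * f y) := by
    rw [hu', hw', ← integral_const_mul, ← integral_const_mul, ← integral_sub (hf.const_mul _) hbf,
      ← integral_sub (hKf.const_mul _) hKbf, ← integral_const_mul, ← integral_sub]
    · congr 1
      ext y
      ring
    · exact ((hf.const_mul _).sub hbf).const_mul _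
    · exact (hKf.const_mul _).sub hKbf
  have h1 : ‖k * (b x * (∫ y, f y) - ∫ y, b y * f y) - (b x * u - w)‖ ≤
      δ * ‖k‖ * ∫ y, ‖b x - b y‖ * ‖f y‖ := by
    rw [e, ← integral_const_mul]
    refine norm_integral_le_of_norm_le (hd.const_mul _) (ae_of_all _ fun y => ?_)
    by_cases hy : f y = 0
    · simp [hy]
    · rw [norm_mul, norm_mul, norm_sub_rev]
      gcongr
      exact (hsupp y hy).2
  have h2 : ‖k‖ * ‖b x * (∫ y, f y) - ∫ y, b y * f y‖ ≤
      ‖b x * u - w‖ + δ * ‖k‖ * ∫ y, ‖b x - b y‖ * ‖f y‖ := by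
    rw [← norm_mul]
    have := norm_le_norm_add_norm_sub' (k * (b x * (∫ y, f y) - ∫ y, b y * f y)) (b x * u - w)
    linarith
  calc _ = ‖k‖⁻¹ * (‖k‖ * ‖b x * (∫ y, f y) - ∫ y, b y * f y‖) := by
        rw [inv_mul_cancel_left₀ hk0.ne']
    _ ≤ ‖k‖⁻¹ * (‖b x * u - w‖ + δ * ‖k‖ * ∫ y, ‖b x - b y‖ * ‖f y‖) := by gcongr
    _ = _ := by field_simp

theorem volume_ball_eq_ofReal (x : 𝔼 n) {r : ℝ} (hr : 0 < r) :
    volume (Metric.ball x r) = ENNReal.ofReal (r ^ n * volume.real (Metric.ball (0 : 𝔼 n) 1)) := by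
  rw [Measure.addHaar_ball_of_pos volume x hr, ENNReal.ofReal_mul (by positivity),
    finrank_euclideanSpace_fin, ofReal_measureReal measure_ball_lt_top.ne]

theorem eLpNorm_le_of_norm_le_one {p s : ℝ} (hp : 0 < p) (hs : 0 < s) {f : 𝔼 n → ℂ} {y₀ : 𝔼 n}
    (hf1 : ∀ y, ‖f y‖ ≤ 1) (hf0 : ∀ y, y ∉ Metric.ball y₀ s → f y = 0) :
    eLpNorm f (ENNReal.ofReal p) volume ≤
      ENNReal.ofReal ((s ^ n * volume.real (Metric.ball (0 : 𝔼 n) 1)) ^ (1 / p)) := by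
  calc eLpNorm f (ENNReal.ofReal p) volume
      ≤ eLpNorm ((Metric.ball y₀ s).indicator fun _ => (1 : ℝ)) (ENNReal.ofReal p) volume := by
        refine eLpNorm_mono fun y => ?_
        by_cases hy : y ∈ Metric.ball y₀ s
        · rw [Set.indicator_of_mem hy, norm_one]
          exact hf1 y
        · rw [hf0 y hy, norm_zero]
          positivity
    _ = _ := by
        rw [eLpNorm_indicator_const Metric.isOpen_ball.measurableSet (by simpa using hp)
          ENNReal.ofReal_ne_top, ENNReal.toReal_ofReal hp.le, enorm_one, one_mul,
          volume_ball_eq_ofReal _ hs, ENNReal.ofReal_rpow_of_nonneg (by positivity) (by positivity)]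

/-- The main estimate for commutators, tested on smooth functions. -/
theorem CommutatorBounded.exists_lintegral_le_of_contDiff (hΩ : IsCZAngular Ω) {α p q δ : ℝ}
    (hp : 1 < p) (hpq : 1 / q = 1 / p - α / n) (hq : 1 < q) (hδ : 0 < δ) {b : 𝔼 n → ℂ}
    (hb : LocallyIntegrable b) (h : CommutatorBounded Ω b p (weakLpNorm q)) :
    ∃ (e : 𝔼 n) (M : ℝ), 0 ≤ M ∧ ∀ (x₀ : 𝔼 n) (r : ℝ), 0 < r → ∀ f : 𝔼 n → ℂ, ContDiff ℝ ∞ f →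
      (∀ y, ‖f y‖ ≤ 1) → (∀ y, y ∉ Metric.ball (x₀ - r • e) (2 * r) → f y = 0) →
      ∫⁻ x in Metric.ball x₀ r, ‖b x * (∫ y, f y) - ∫ y, b y * f y‖ₑ ≤
        ENNReal.ofReal (M * r ^ (2 * n + α)) + ENNReal.ofReal δ *
          ∫⁻ y, (∫⁻ x in Metric.ball x₀ r, ‖b x - b y‖ₑ) * ‖f y‖ₑ := by
  obtain ⟨A, ⟨C, hC⟩, hA⟩ := h
  obtain ⟨e, k, hk, hker⟩ := hΩ.exists_czKernel_approx hδ
  have hp0 : 0 < p := by linarith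
  have hn : (0 : ℝ) < n := by exact_mod_cast hΩ.dim_pos
  have hq1 : 0 < q - 1 := by linarith
  obtain ⟨v, hv⟩ : ∃ v : ℝ, v = volume.real (Metric.ball (0 : 𝔼 n) 1) := ⟨_, rfl⟩
  have hv0 : 0 < v := hv ▸
    ENNReal.toReal_pos (Metric.measure_ball_pos _ _ one_pos).ne' measure_ball_lt_top.ne
  have hk0 : 0 < ‖k‖ := norm_pos_iff.2 hk
  refine ⟨e, ‖k‖⁻¹ * (q / (q - 1) * ((C + 1) * (2 ^ n * v) ^ (1 / p)) * v ^ (1 - 1 / q)),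
    by positivity, fun x₀ r hr f hf hf1 hf0 => ?_⟩
  have hfs : HasCompactSupport f := HasCompactSupport.intro
    (isCompact_closedBall (x₀ - r • e) (2 * r))
    fun y hy => hf0 y fun hy' => hy (Metric.ball_subset_closedBall hy')
  have hfi : Integrable f := hf.continuous.integrable_of_hasCompactSupport hfs
  have hbf : Integrable fun y => b y * f y := by
    refine (hb.integrable_smul_left_of_hasCompactSupport hf.continuous hfs).congr
      (ae_of_all _ fun y => ?_)
    simp only [smul_eq_mul, mul_comm]
  have hfp : MemLp f (ENNReal.ofReal p) := hf.continuous.memLp_of_hasCompactSupport hfs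
  obtain ⟨F, hF⟩ : ∃ F : Lp ℂ (ENNReal.ofReal p) (volume : Measure (𝔼 n)), F =ᵐ[volume] f :=
    ⟨hfp.toLp f, hfp.coeFn_toLp⟩
  -- A bound for C times the L^p norm of f; C + 1 in place of C makes it strictly positive.
  obtain ⟨N, hN⟩ : ∃ N : ℝ, N = (C + 1) * ((2 * r) ^ n * v) ^ (1 / p) := ⟨_, rfl⟩
  have hN0 : 0 < N := by rw [hN]; positivity
  have hAN : weakLpNorm q (A F) ≤ ENNReal.ofReal N := by
    refine (hC F).trans ?_
    rw [eLpNorm_congr_ae hF]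
    calc (C : ENNReal) * eLpNorm f (ENNReal.ofReal p) volume
        ≤ C * ENNReal.ofReal (((2 * r) ^ n * v) ^ (1 / p)) := by
          gcongr
          rw [hv]
          exact eLpNorm_le_of_norm_le_one hp0 (by positivity) hf1 hf0
      _ = ENNReal.ofReal (C * ((2 * r) ^ n * v) ^ (1 / p)) := by
          rw [ENNReal.ofReal_mul C.coe_nonneg, ENNReal.ofReal_coe_nnreal]
      _ ≤ _ := by
          refine ENNReal.ofReal_le_ofReal ?_
          rw [hN]
          gcongr
          linarith
  have hweak := setLIntegral_enorm_le_of_weakLpNorm_le hq hN0 (A F).aestronglyMeasurable hAN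
    (by positivity : 0 < r ^ n * v) (hv ▸ volume_ball_eq_ofReal x₀ hr)
  have hkr : k / ((r ^ n : ℝ) : ℂ) ≠ 0 :=
    div_ne_zero hk (by exact_mod_cast (by positivity : (0 : ℝ) < r ^ n).ne')
  have hpt : ∀ᵐ x, x ∈ Metric.ball x₀ r → ‖b x * (∫ y, f y) - ∫ y, b y * f y‖ₑ ≤
      ENNReal.ofReal (‖k‖⁻¹ * r ^ n) * ‖A F x‖ₑ +
        ENNReal.ofReal δ * ∫⁻ y, ‖b x - b y‖ₑ * ‖f y‖ₑ := by
    filter_upwards [hA f hf hfs F hF] with x hx hxQ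
    have hsupp : ∀ y, f y ≠ 0 → r ≤ ‖x - y‖ ∧
        ‖czKernel Ω (x - y) - k / ((r ^ n : ℝ) : ℂ)‖ ≤ δ * ‖k / ((r ^ n : ℝ) : ℂ)‖ := by
      intro y hy
      have hyB : y ∈ Metric.ball (x₀ - r • e) (2 * r) := by
        by_contra hyB
        exact hy (hf0 y hyB)
      refine hker r hr (x - y) ?_
      rw [Metric.mem_ball, dist_eq_norm] at hxQ hyB
      have e1 : x - y - r • e = (x - x₀) - (y - (x₀ - r • e)) := by abel
      rw [e1]
      -- Here r + 2r = 3r. The support of f may have radius 2r so that mollifications of functions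
      -- supported in the ball of radius r are still admissible.
      exact (norm_sub_le _ _).trans_lt (by linarith)
    have h1 := norm_mul_integral_sub_integral_le hΩ hr hkr hfi hbf hsupp hx
    have hd : Integrable fun y => (b x - b y) * f y := by
      refine ((hfi.const_mul (b x)).sub hbf).congr (ae_of_all _ fun y => ?_)
      simp only [Pi.sub_apply, sub_mul]
    have e2 : ∫⁻ y, ‖b x - b y‖ₑ * ‖f y‖ₑ = ENNReal.ofReal (∫ y, ‖b x - b y‖ * ‖f y‖) := by
      simp_rw [← norm_mul, ← enorm_mul]
      exact (ofReal_integral_norm_eq_lintegral_enorm hd).symm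
    have e3 : ‖k / ((r ^ n : ℝ) : ℂ)‖⁻¹ = ‖k‖⁻¹ * r ^ n := by
      rw [norm_div, Complex.norm_real, Real.norm_of_nonneg (by positivity), inv_div]
      ring
    rw [e2, ← ofReal_norm, ← ofReal_norm, ← ENNReal.ofReal_mul (by positivity),
      ← ENNReal.ofReal_mul hδ.le, ← ENNReal.ofReal_add (by positivity)
      (mul_nonneg hδ.le (integral_nonneg fun y => by positivity)), ← e3]
    exact ENNReal.ofReal_le_ofReal h1
  have hbm : AEStronglyMeasurable b (volume.restrict (Metric.ball x₀ r)) :=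
    hb.aestronglyMeasurable.restrict
  have hswap : ∫⁻ x in Metric.ball x₀ r, ∫⁻ y, ‖b x - b y‖ₑ * ‖f y‖ₑ =
      ∫⁻ y, (∫⁻ x in Metric.ball x₀ r, ‖b x - b y‖ₑ) * ‖f y‖ₑ := by
    rw [lintegral_lintegral_swap]
    · refine lintegral_congr fun y => ?_
      rw [lintegral_mul_const' _ _ enorm_ne_top]
    · exact ((hbm.comp_fst.sub hb.aestronglyMeasurable.comp_snd).enorm).mul
        (hfi.aestronglyMeasurable.comp_snd.enorm)
  calc _ ≤ ∫⁻ x in Metric.ball x₀ r, (ENNReal.ofReal (‖k‖⁻¹ * r ^ n) * ‖A F x‖ₑ +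
        ENNReal.ofReal δ * ∫⁻ y, ‖b x - b y‖ₑ * ‖f y‖ₑ) :=
        setLIntegral_mono_ae' Metric.isOpen_ball.measurableSet hpt
    _ = ENNReal.ofReal (‖k‖⁻¹ * r ^ n) * (∫⁻ x in Metric.ball x₀ r, ‖A F x‖ₑ) +
        ENNReal.ofReal δ * ∫⁻ x in Metric.ball x₀ r, ∫⁻ y, ‖b x - b y‖ₑ * ‖f y‖ₑ := by
        rw [lintegral_add_left', lintegral_const_mul' _ _ ENNReal.ofReal_ne_top,
          lintegral_const_mul' _ _ ENNReal.ofReal_ne_top]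
        exact (A F).aestronglyMeasurable.enorm.restrict.const_mul _
    _ ≤ ENNReal.ofReal (‖k‖⁻¹ * r ^ n) *
        ENNReal.ofReal (q / (q - 1) * N * (r ^ n * v) ^ (1 - 1 / q)) +
        ENNReal.ofReal δ * ∫⁻ x in Metric.ball x₀ r, ∫⁻ y, ‖b x - b y‖ₑ * ‖f y‖ₑ := by gcongr
    _ = _ := by
        rw [hswap, ← ENNReal.ofReal_mul (by positivity)]
        congr 2
        have e4 : N = (C + 1) * (2 ^ n * v) ^ (1 / p) * r ^ ((n : ℝ) * (1 / p)) := by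
          rw [hN, mul_pow, mul_right_comm, Real.mul_rpow (by positivity) (by positivity),
            ← Real.rpow_natCast r, ← Real.rpow_mul hr.le]
          ring
        have e5 : (r ^ n * v) ^ (1 - 1 / q) = v ^ (1 - 1 / q) * r ^ ((n : ℝ) * (1 - 1 / q)) := by
          rw [Real.mul_rpow (by positivity) hv0.le, ← Real.rpow_natCast r, ← Real.rpow_mul hr.le]
          ring
        -- The factors come from 1/κ, from the L^p norm of f, and from weak L^q on the ball; n/p -
        -- n/q = α makes the exponents add up to 2n + α.
        have e6 : r ^ n * r ^ ((n : ℝ) * (1 / p)) * r ^ ((n : ℝ) * (1 - 1 / q)) =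
            r ^ (2 * n + α) := by
          rw [← Real.rpow_natCast r, ← Real.rpow_add hr, ← Real.rpow_add hr, hpq]
          congr 1
          field_simp
          ring
        rw [e4, e5, ← e6]
        ring

end LowerBound

/-! ### From bounded commutators to small mean oscillation -/

section MeanOscillation

variable {n : ℕ} {Ω : EuclideanSpace ℝ (Fin n) → ℂ}

local notation "𝔼" n:max => EuclideanSpace ℝ (Fin n)

theorem integrable_of_norm_le_one {f : 𝔼 n → ℂ} (hf : AEStronglyMeasurable f)
    (hf1 : ∀ y, ‖f y‖ ≤ 1) {y₀ : 𝔼 n} {s : ℝ} (hf0 : ∀ y, y ∉ Metric.ball y₀ s → f y = 0) :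
    Integrable f := by
  have h : IntegrableOn f (Metric.ball y₀ s) :=
    Measure.integrableOn_of_bounded measure_ball_lt_top.ne hf (ae_of_all _ hf1)
  exact (integrableOn_iff_integrable_of_support_subset fun y hy => by
    by_contra h'
    exact hy (hf0 y h')).1 h

/-- Smooth approximation of a bounded function supported in a ball. -/
theorem exists_contDiff_tendsto_ae {f : 𝔼 n → ℂ} (hf : AEStronglyMeasurable f)
    (hf1 : ∀ y, ‖f y‖ ≤ 1) {y₀ : 𝔼 n} {s : ℝ} (hs : 0 < s)
    (hf0 : ∀ y, y ∉ Metric.ball y₀ s → f y = 0) :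
    ∃ F : ℕ → 𝔼 n → ℂ, (∀ k, ContDiff ℝ ∞ (F k)) ∧ (∀ k y, ‖F k y‖ ≤ 1) ∧
      (∀ k y, y ∉ Metric.ball y₀ (2 * s) → F k y = 0) ∧
      ∀ᵐ y, Tendsto (fun k => F k y) atTop (𝓝 (f y)) := by
  have hfi := integrable_of_norm_le_one hf hf1 hf0
  -- Outer radii at most s keep the mollified functions supported in the doubled ball. The fixed
  -- ratio 2 of outer to inner radius is what almost everywhere convergence requires.
  let φ : ℕ → ContDiffBump (0 : 𝔼 n) := fun k =>
    { rIn := s / (k + 1) / 2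
      rOut := s / (k + 1)
      rIn_pos := by positivity
      rIn_lt_rOut := half_lt_self (by positivity) }
  have hrOut : ∀ k, (φ k).rOut ≤ s := fun k =>
    div_le_self hs.le (by linarith [(Nat.cast_nonneg k : (0 : ℝ) ≤ k)])
  refine ⟨fun k => convolution ((φ k).normed volume) f (ContinuousLinearMap.lsmul ℝ ℝ) volume,
    fun k => ?_, fun k y => ?_, fun k y hy => ?_, ?_⟩
  · exact (φ k).hasCompactSupport_normed.contDiff_convolution_left _ (φ k).contDiff_normed
      hfi.locallyIntegrable
  · beta_reduce
    rw [convolution_def]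
    refine (norm_integral_le_of_norm_le (φ k).integrable_normed (ae_of_all _ fun t => ?_)).trans
      (φ k).integral_normed.le
    rw [ContinuousLinearMap.lsmul_apply, norm_smul, Real.norm_of_nonneg ((φ k).nonneg_normed t)]
    exact mul_le_of_le_one_right ((φ k).nonneg_normed t) (hf1 _)
  · beta_reduce
    rw [convolution_def]
    refine integral_eq_zero_of_ae (ae_of_all _ fun t => ?_)
    by_cases ht : t ∈ Metric.ball (0 : 𝔼 n) (φ k).rOut
    · have : f (y - t) = 0 := by
        refine hf0 _ fun h => hy ?_
        rw [mem_ball_zero_iff] at ht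
        rw [Metric.mem_ball, dist_eq_norm] at h ⊢
        calc ‖y - y₀‖ = ‖(y - t - y₀) + t‖ := by congr 1; abel
          _ ≤ ‖y - t - y₀‖ + ‖t‖ := norm_add_le _ _
          _ < 2 * s := by linarith [hrOut k]
      simp [this]
    · rw [← (φ k).support_normed_eq (μ := volume), Function.notMem_support] at ht
      simp [ht]
  · refine ContDiffBump.ae_convolution_tendsto_right_of_locallyIntegrable (K := 2) ?_ ?_
      hfi.locallyIntegrable
    · exact tendsto_const_div_atTop_nhds_zero_nat s |>.comp (tendsto_add_atTop_nat 1) |>.congr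
        fun k => by simp [φ]
    · refine Eventually.of_forall fun k => ?_
      simp only [φ]
      linarith

theorem aemeasurable_lintegral_enorm_sub {b : 𝔼 n → ℂ} (hb : AEStronglyMeasurable b)
    (Q : Set (𝔼 n)) : AEMeasurable fun y => ∫⁻ x in Q, ‖b x - b y‖ₑ := by
  have h : AEMeasurable (fun z : 𝔼 n × 𝔼 n => ‖b z.2 - b z.1‖ₑ)
      (volume.prod (volume.restrict Q)) :=
    (hb.restrict.comp_snd.sub hb.comp_fst).enorm
  exact h.lintegral_prod_right'

/-- Finiteness, with no quantitative content: it provides the majorant for dominated convergence,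
and it allows the double oscillation to be absorbed into the left side of its own estimate. -/
theorem lintegral_lintegral_enorm_sub_lt_top {b : 𝔼 n → ℂ} (hb : LocallyIntegrable b)
    (x₀ y₀ : 𝔼 n) (r s : ℝ) :
    ∫⁻ y in Metric.ball y₀ s, (∫⁻ x in Metric.ball x₀ r, ‖b x - b y‖ₑ) < ⊤ := by
  have hfin : ∀ (x₀ : 𝔼 n) (r : ℝ), ∫⁻ x in Metric.ball x₀ r, ‖b x‖ₑ < ⊤ := fun x₀ r =>
    ((hb.integrableOn_isCompact (isCompact_closedBall x₀ r)).mono_set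
      Metric.ball_subset_closedBall).2
  calc _ ≤ ∫⁻ y in Metric.ball y₀ s, ((∫⁻ x in Metric.ball x₀ r, ‖b x‖ₑ) +
        ‖b y‖ₑ * volume (Metric.ball x₀ r)) := by
        refine lintegral_mono fun y => ?_
        calc _ ≤ ∫⁻ x in Metric.ball x₀ r, (‖b x‖ₑ + ‖b y‖ₑ) :=
              lintegral_mono fun x => enorm_sub_le
          _ = _ := by rw [lintegral_add_right _ measurable_const, setLIntegral_const]
    _ = (∫⁻ x in Metric.ball x₀ r, ‖b x‖ₑ) * volume (Metric.ball y₀ s) +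
        (∫⁻ y in Metric.ball y₀ s, ‖b y‖ₑ) * volume (Metric.ball x₀ r) := by
        rw [lintegral_add_left measurable_const, setLIntegral_const,
          lintegral_mul_const' _ _ measure_ball_lt_top.ne]
    _ < ⊤ := ENNReal.add_lt_top.2 ⟨ENNReal.mul_lt_top (hfin _ _) measure_ball_lt_top,
        ENNReal.mul_lt_top (hfin _ _) measure_ball_lt_top⟩

/-- The main estimate for commutators, tested on bounded functions. -/
theorem CommutatorBounded.exists_lintegral_le (hΩ : IsCZAngular Ω) {α p q δ : ℝ}
    (hp : 1 < p) (hpq : 1 / q = 1 / p - α / n) (hq : 1 < q) (hδ : 0 < δ) {b : 𝔼 n → ℂ}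
    (hb : LocallyIntegrable b) (h : CommutatorBounded Ω b p (weakLpNorm q)) :
    ∃ (e : 𝔼 n) (M : ℝ), 0 ≤ M ∧ ∀ (x₀ : 𝔼 n) (r : ℝ), 0 < r → ∀ f : 𝔼 n → ℂ,
      AEStronglyMeasurable f volume → (∀ y, ‖f y‖ ≤ 1) →
      (∀ y, y ∉ Metric.ball (x₀ - r • e) r → f y = 0) →
      ∫⁻ x in Metric.ball x₀ r, ‖b x * (∫ y, f y) - ∫ y, b y * f y‖ₑ ≤
        ENNReal.ofReal (M * r ^ (2 * n + α)) + ENNReal.ofReal δ *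
          ∫⁻ y, (∫⁻ x in Metric.ball x₀ r, ‖b x - b y‖ₑ) * ‖f y‖ₑ := by
  obtain ⟨e, M, hM, hmain⟩ := h.exists_lintegral_le_of_contDiff hΩ hp hpq hq hδ hb
  refine ⟨e, M, hM, fun x₀ r hr f hf hf1 hf0 => ?_⟩
  obtain ⟨F, hFs, hF1, hF0, hFlim⟩ := exists_contDiff_tendsto_ae hf hf1 hr hf0
  set B := Metric.ball (x₀ - r • e) (2 * r) with hB
  have hBm : MeasurableSet B := Metric.isOpen_ball.measurableSet
  have hbB : IntegrableOn b B :=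
    (hb.integrableOn_isCompact (isCompact_closedBall _ _)).mono_set Metric.ball_subset_closedBall
  have hI1 : Tendsto (fun k => ∫ y, F k y) atTop (𝓝 (∫ y, f y)) := by
    refine tendsto_integral_of_dominated_convergence (B.indicator fun _ => (1 : ℝ))
      (fun k => (hFs k).continuous.aestronglyMeasurable) ?_ (fun k => ae_of_all _ fun y => ?_) hFlim
    · exact (integrable_indicator_iff hBm).2 (integrableOn_const measure_ball_lt_top.ne)
    · by_cases hy : y ∈ B
      · rw [Set.indicator_of_mem hy]
        exact hF1 k y
      · rw [Set.indicator_of_notMem hy, hF0 k y hy, norm_zero]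
  have hI2 : Tendsto (fun k => ∫ y, b y * F k y) atTop (𝓝 (∫ y, b y * f y)) := by
    refine tendsto_integral_of_dominated_convergence (B.indicator fun y => ‖b y‖)
      (fun k => hb.aestronglyMeasurable.mul (hFs k).continuous.aestronglyMeasurable) ?_
      (fun k => ae_of_all _ fun y => ?_) ?_
    · exact (integrable_indicator_iff hBm).2 hbB.norm
    · by_cases hy : y ∈ B
      · rw [Set.indicator_of_mem hy, norm_mul]
        exact mul_le_of_le_one_right (norm_nonneg _) (hF1 k y)
      · rw [Set.indicator_of_notMem hy, hF0 k y hy, mul_zero, norm_zero]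
    · filter_upwards [hFlim] with y hy
      exact hy.const_mul _
  have hD : Tendsto (fun k => ∫⁻ y, (∫⁻ x in Metric.ball x₀ r, ‖b x - b y‖ₑ) * ‖F k y‖ₑ) atTop
      (𝓝 (∫⁻ y, (∫⁻ x in Metric.ball x₀ r, ‖b x - b y‖ₑ) * ‖f y‖ₑ)) := by
    have hdm := aemeasurable_lintegral_enorm_sub hb.aestronglyMeasurable (Metric.ball x₀ r)
    have hdB := lintegral_lintegral_enorm_sub_lt_top hb x₀ (x₀ - r • e) r (2 * r)
    have hdB' : ∫⁻ y, B.indicator (fun y => ∫⁻ x in Metric.ball x₀ r, ‖b x - b y‖ₑ) y ≠ ⊤ := by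
      rw [lintegral_indicator hBm]
      exact hdB.ne
    refine tendsto_lintegral_of_dominated_convergence'
      (B.indicator fun y => ∫⁻ x in Metric.ball x₀ r, ‖b x - b y‖ₑ)
      (fun k => hdm.mul (hFs k).continuous.aestronglyMeasurable.enorm)
      (fun k => ae_of_all _ fun y => ?_) hdB' ?_
    · by_cases hy : y ∈ B
      · rw [Set.indicator_of_mem hy]
        refine mul_le_of_le_one_right' ?_
        rw [← ofReal_norm]
        exact ENNReal.ofReal_le_one.2 (hF1 k y)
      · beta_reduce
        rw [Set.indicator_of_notMem hy, hF0 k y hy, enorm_zero, mul_zero]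
    · have hfin : ∀ᵐ y, B.indicator (fun y => ∫⁻ x in Metric.ball x₀ r, ‖b x - b y‖ₑ) y < ⊤ :=
        ae_lt_top' (hdm.indicator hBm) hdB'
      filter_upwards [hFlim, hfin] with y hy hyfin
      by_cases hyB : y ∈ B
      · rw [Set.indicator_of_mem hyB] at hyfin
        exact ENNReal.Tendsto.const_mul hy.enorm (Or.inr hyfin.ne)
      · have h0 : f y = 0 := hf0 y fun h => hyB (Metric.ball_subset_ball (by linarith) h)
        simp [h0, hF0 _ y hyB]
  -- Fatou's lemma on the left, dominated convergence on the right.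
  calc ∫⁻ x in Metric.ball x₀ r, ‖b x * (∫ y, f y) - ∫ y, b y * f y‖ₑ
      = ∫⁻ x in Metric.ball x₀ r,
          liminf (fun k => ‖b x * (∫ y, F k y) - ∫ y, b y * F k y‖ₑ) atTop := by
        refine lintegral_congr fun x => ?_
        exact (((hI1.const_mul (b x)).sub hI2).enorm.liminf_eq).symm
    _ ≤ liminf (fun k => ∫⁻ x in Metric.ball x₀ r,
          ‖b x * (∫ y, F k y) - ∫ y, b y * F k y‖ₑ) atTop := by
        refine lintegral_liminf_le' fun k => ?_
        exact ((hb.aestronglyMeasurable.restrict.mul_const _).sub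
          aestronglyMeasurable_const).enorm
    _ ≤ liminf (fun k => ENNReal.ofReal (M * r ^ (2 * n + α)) + ENNReal.ofReal δ *
          ∫⁻ y, (∫⁻ x in Metric.ball x₀ r, ‖b x - b y‖ₑ) * ‖F k y‖ₑ) atTop := by
        refine liminf_le_liminf (Eventually.of_forall fun k => ?_)
        exact hmain x₀ r hr (F k) (hFs k) (hF1 k) (hF0 k)
    _ = _ := ((ENNReal.Tendsto.const_mul hD (Or.inr ENNReal.ofReal_ne_top)).const_add _).liminf_eq

/-- A symbol with bounded commutator has small mean oscillation. -/
theorem CommutatorBounded.exists_mean_oscillation_le (hΩ : IsCZAngular Ω) {α p q : ℝ}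
    (hp : 1 < p) (hpq : 1 / q = 1 / p - α / n) (hq : 1 < q) {b : 𝔼 n → ℂ}
    (hb : LocallyIntegrable b) (h : CommutatorBounded Ω b p (weakLpNorm q)) :
    ∃ M : ℝ, 0 ≤ M ∧ ∀ (x₀ : 𝔼 n) (r : ℝ), 0 < r → ∃ c : ℂ,
      ∫⁻ x in Metric.ball x₀ r, ‖b x - c‖ₑ ≤ ENNReal.ofReal (M * r ^ (n + α)) := by
  -- With δ = 1/6 the estimates below give D ≤ 3(m + D/6), hence D ≤ 6m, and then V X ≤ m + D/6 ≤
  -- 2m.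
  obtain ⟨e, M, hM, hmain⟩ := h.exists_lintegral_le hΩ hp hpq hq (by norm_num : (0 : ℝ) < 1 / 6) hb
  obtain ⟨v, hv⟩ : ∃ v : ℝ, v = volume.real (Metric.ball (0 : 𝔼 n) 1) := ⟨_, rfl⟩
  have hv0 : 0 < v := hv ▸
    ENNReal.toReal_pos (Metric.measure_ball_pos _ _ one_pos).ne' measure_ball_lt_top.ne
  refine ⟨2 * M / v, by positivity, fun x₀ r hr => ?_⟩
  specialize hmain x₀ r hr
  set m : ℝ := M * r ^ (2 * n + α) with hm
  have hm0 : 0 ≤ m := by positivity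
  set Q := Metric.ball x₀ r with hQ
  set Q' := Metric.ball (x₀ - r • e) r with hQ'
  have hQm : MeasurableSet Q := Metric.isOpen_ball.measurableSet
  have hQm' : MeasurableSet Q' := Metric.isOpen_ball.measurableSet
  obtain ⟨V, hV⟩ : ∃ V : ℝ, V = r ^ n * v := ⟨_, rfl⟩
  have hV0 : 0 < V := by rw [hV]; positivity
  have hQV : volume Q = ENNReal.ofReal V := by rw [hV, hv]; exact volume_ball_eq_ofReal _ hr
  have hQV' : volume Q' = ENNReal.ofReal V := by rw [hV, hv]; exact volume_ball_eq_ofReal _ hr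
  have hreal : ∀ {S : Set (𝔼 n)}, volume S = ENNReal.ofReal V → volume.real S = V := fun hS => by
    rw [Measure.real, hS, ENNReal.toReal_ofReal hV0.le]
  have hVC : (V : ℂ) ≠ 0 := by exact_mod_cast hV0.ne'
  have hVe : ‖(V : ℂ)‖ₑ = ENNReal.ofReal V := by
    rw [← ofReal_norm, Complex.norm_real, Real.norm_of_nonneg hV0.le]
  have hbQ : ∀ z : 𝔼 n, IntegrableOn b (Metric.ball z r) := fun z =>
    (hb.integrableOn_isCompact (isCompact_closedBall _ _)).mono_set Metric.ball_subset_closedBall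
  have hconst : ∀ (z : 𝔼 n) (c : ℂ), IntegrableOn (fun _ => c) (Metric.ball z r) := fun z c =>
    integrableOn_const measure_ball_lt_top.ne
  set a : ℂ := (V : ℂ)⁻¹ * ∫ x in Q, b x with ha
  set a' : ℂ := (V : ℂ)⁻¹ * ∫ x in Q', b x with ha'
  have haV : ∫ x in Q, b x = V * a := by rw [ha, mul_inv_cancel_left₀ hVC]
  have haV' : ∫ x in Q', b x = V * a' := by rw [ha', mul_inv_cancel_left₀ hVC]
  set d : 𝔼 n → ENNReal := fun y => ∫⁻ x in Q, ‖b x - b y‖ₑ with hd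
  set D : ENNReal := ∫⁻ y in Q', d y with hD
  set X : ENNReal := ∫⁻ x in Q, ‖b x - a'‖ₑ with hX
  set Y : ENNReal := ∫⁻ y in Q', ‖a - b y‖ₑ with hY
  have hDle : ∀ f : 𝔼 n → ℂ, (∀ y, ‖f y‖ ≤ 1) → (∀ y, y ∉ Q' → f y = 0) →
      ∫⁻ y, d y * ‖f y‖ₑ ≤ D := by
    intro f hf1 hf0
    rw [hD, ← lintegral_indicator hQm']
    refine lintegral_mono fun y => ?_
    by_cases hy : y ∈ Q'
    · rw [Set.indicator_of_mem hy]
      refine mul_le_of_le_one_right' ?_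
      rw [← ofReal_norm]
      exact ENNReal.ofReal_le_one.2 (hf1 y)
    · rw [hf0 y hy, enorm_zero, mul_zero]
      exact zero_le
  have hJ : ∀ f : 𝔼 n → ℂ, AEStronglyMeasurable f volume → (∀ y, ‖f y‖ ≤ 1) →
      (∀ y, y ∉ Q' → f y = 0) →
      ∫⁻ x in Q, ‖b x * (∫ y, f y) - ∫ y, b y * f y‖ₑ ≤
        ENNReal.ofReal m + ENNReal.ofReal (1 / 6) * D := fun f hf hf1 hf0 => by
    refine (hmain f hf hf1 hf0).trans ?_
    gcongr
    exact hDle f hf1 hf0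
  -- testing on the characteristic function of `Q'`
  have h1 : ENNReal.ofReal V * X ≤ ENNReal.ofReal m + ENNReal.ofReal (1 / 6) * D := by
    have h := hJ (Q'.indicator fun _ => 1)
      ((measurable_const.indicator hQm').aestronglyMeasurable)
      (fun y => by by_cases hy : y ∈ Q' <;> simp [hy]) (fun y hy => by simp [hy])
    have e1 : ∫ y, Q'.indicator (fun _ => (1 : ℂ)) y = V := by
      rw [integral_indicator hQm', setIntegral_const, hreal hQV']
      simp
    have e2 : ∫ y, b y * Q'.indicator (fun _ => (1 : ℂ)) y = V * a' := by
      rw [← haV', ← integral_indicator hQm']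
      congr 1
      ext y
      by_cases hy : y ∈ Q' <;> simp [hy]
    rw [e1, e2] at h
    convert h using 1
    rw [hX, ← lintegral_const_mul' _ _ ENNReal.ofReal_ne_top]
    refine lintegral_congr fun x => ?_
    rw [← hVe, ← enorm_mul]
    congr 1
    ring
  -- testing on the conjugate of the sign of `a - b` on `Q'`
  have h2 : ENNReal.ofReal V * Y ≤ ENNReal.ofReal m + ENNReal.ofReal (1 / 6) * D := by
    set σ : ℂ → ℂ := fun z => (starRingEnd ℂ) z / (‖z‖ : ℂ) with hσ
    have hσm : Measurable σ := by
      refine Measurable.div ?_ ?_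
      · exact Complex.continuous_conj.measurable
      · exact Complex.measurable_ofReal.comp measurable_norm
    have hσ1 : ∀ z, ‖σ z‖ ≤ 1 := fun z => by
      simp only [hσ, norm_div, RCLike.norm_conj, Complex.norm_real, norm_norm]
      exact div_self_le_one _
    have hσz : ∀ z, z * σ z = (‖z‖ : ℂ) := fun z => by
      simp only [hσ]
      rw [← mul_div_assoc, Complex.mul_conj, Complex.normSq_eq_norm_sq]
      by_cases hz : ‖z‖ = 0
      · simp [hz]
      · have : (‖z‖ : ℂ) ≠ 0 := by exact_mod_cast hz
        field_simp
        push_cast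
        ring
    set f : 𝔼 n → ℂ := Q'.indicator fun y => σ (a - b y) with hf
    have hfm : AEStronglyMeasurable f volume := by
      refine AEStronglyMeasurable.indicator ?_ hQm'
      exact (hσm.comp_aemeasurable
        (aemeasurable_const.sub hb.aestronglyMeasurable.aemeasurable)).aestronglyMeasurable
    have hf1 : ∀ y, ‖f y‖ ≤ 1 := fun y => by
      by_cases hy : y ∈ Q'
      · rw [hf, Set.indicator_of_mem hy]
        exact hσ1 _
      · rw [hf, Set.indicator_of_notMem hy, norm_zero]
        exact zero_le_one
    have hf0 : ∀ y, y ∉ Q' → f y = 0 := fun y hy => Set.indicator_of_notMem hy _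
    have hfi : Integrable f := integrable_of_norm_le_one hfm hf1 hf0
    have hbf : Integrable fun y => b y * f y := by
      have : IntegrableOn (fun y => b y * f y) Q' :=
        Integrable.mul_bdd (c := 1) (hbQ _) hfm.restrict (ae_of_all _ hf1)
      refine (integrableOn_iff_integrable_of_support_subset fun y hy => ?_).1 this
      by_contra hy'
      exact hy (by simp [hf0 y hy'])
    have hYr : Y = ENNReal.ofReal (∫ y in Q', ‖a - b y‖) :=
      (ofReal_integral_norm_eq_lintegral_enorm ((hconst _ a).sub (hbQ _))).symm
    have e1 : a * (∫ y, f y) - ∫ y, b y * f y = ((∫ y in Q', ‖a - b y‖ : ℝ) : ℂ) := by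
      rw [← integral_const_mul, ← integral_sub (hfi.const_mul a) hbf, ← integral_complex_ofReal,
        ← integral_indicator hQm']
      congr 1
      ext y
      by_cases hy : y ∈ Q'
      · rw [Set.indicator_of_mem hy, hf, Set.indicator_of_mem hy, ← hσz]
        ring
      · rw [Set.indicator_of_notMem hy, hf0 y hy]
        ring
    -- Integrating over x in Q replaces b(x) by its average a, so the sign, which was chosen for a,
    -- produces |a - b| exactly.
    have e2 : ∫ x in Q, (b x * (∫ y, f y) - ∫ y, b y * f y) =
        V * ((∫ y in Q', ‖a - b y‖ : ℝ) : ℂ) := by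
      rw [integral_sub ((hbQ x₀).mul_const _) (hconst x₀ _), integral_mul_const, setIntegral_const,
        hreal hQV, haV, ← e1, Complex.real_smul]
      ring
    calc ENNReal.ofReal V * Y = ‖∫ x in Q, (b x * (∫ y, f y) - ∫ y, b y * f y)‖ₑ := by
          rw [e2, enorm_mul, hVe, hYr, ← ofReal_norm, Complex.norm_real,
            Real.norm_of_nonneg (integral_nonneg fun y => norm_nonneg _)]
      _ ≤ ∫⁻ x in Q, ‖b x * (∫ y, f y) - ∫ y, b y * f y‖ₑ := enorm_integral_le_lintegral_enorm _
      _ ≤ _ := hJ f hfm hf1 hf0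
  have h3 : ENNReal.ofReal V * ‖a' - a‖ₑ ≤ X := by
    rw [← hVe, ← enorm_mul, mul_sub, enorm_sub_rev]
    have : V * a - V * a' = ∫ x in Q, (b x - a') := by
      rw [integral_sub (hbQ x₀) (hconst x₀ _), setIntegral_const, hreal hQV, haV,
        Complex.real_smul]
    rw [this]
    exact enorm_integral_le_lintegral_enorm _
  -- From b(x) - b(y) = (b(x) - a') + (a' - a) + (a - b(y)), integrated over Q × Q'. By `h3` the
  -- middle term costs no more than the first.
  have h4 : D ≤ ENNReal.ofReal V * X + (ENNReal.ofReal V * (ENNReal.ofReal V * ‖a' - a‖ₑ) +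
      ENNReal.ofReal V * Y) := by
    have hdy : ∀ y, d y ≤ X + (ENNReal.ofReal V * ‖a' - a‖ₑ + ENNReal.ofReal V * ‖a - b y‖ₑ) := by
      intro y
      calc d y ≤ ∫⁻ x in Q, (‖b x - a'‖ₑ + (‖a' - a‖ₑ + ‖a - b y‖ₑ)) := by
            refine lintegral_mono fun x => ?_
            have : b x - b y = (b x - a') + ((a' - a) + (a - b y)) := by ring
            rw [this]
            refine (enorm_add_le _ _).trans ?_
            gcongr
            exact enorm_add_le _ _
        _ = _ := by
            rw [lintegral_add_right _ measurable_const, setLIntegral_const, hQV]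
            ring
    calc D ≤ ∫⁻ y in Q', (X + (ENNReal.ofReal V * ‖a' - a‖ₑ + ENNReal.ofReal V * ‖a - b y‖ₑ)) :=
          lintegral_mono hdy
      _ = _ := by
          rw [lintegral_add_left measurable_const, lintegral_add_left measurable_const,
            setLIntegral_const, setLIntegral_const, hQV',
            lintegral_const_mul' _ _ ENNReal.ofReal_ne_top]
          ring
  have hDfin : D < ⊤ := lintegral_lintegral_enorm_sub_lt_top hb _ _ _ _
  have hD6 : D ≤ ENNReal.ofReal (6 * m) := by
    have h5 : D ≤ 3 * (ENNReal.ofReal m + ENNReal.ofReal (1 / 6) * D) := by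
      calc D ≤ _ := h4
        _ ≤ ENNReal.ofReal V * X + (ENNReal.ofReal V * X + ENNReal.ofReal V * Y) := by gcongr
        _ ≤ _ := by
          rw [show (3 : ENNReal) = 1 + (1 + 1) by norm_num, add_mul, add_mul, one_mul]
          gcongr
    have hDr : D = ENNReal.ofReal D.toReal := (ENNReal.ofReal_toReal hDfin.ne).symm
    have hDr0 : 0 ≤ D.toReal := ENNReal.toReal_nonneg
    rw [hDr] at h5 ⊢
    rw [← ENNReal.ofReal_mul (by norm_num), ← ENNReal.ofReal_add hm0 (by positivity),
      show (3 : ENNReal) = ENNReal.ofReal 3 by norm_num, ← ENNReal.ofReal_mul (by norm_num),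
      ENNReal.ofReal_le_ofReal_iff (by positivity)] at h5
    exact ENNReal.ofReal_le_ofReal (by linarith)
  refine ⟨a', ?_⟩
  have h6 : ENNReal.ofReal V * X ≤ ENNReal.ofReal (2 * m) := by
    calc _ ≤ _ := h1
      _ ≤ ENNReal.ofReal m + ENNReal.ofReal (1 / 6) * ENNReal.ofReal (6 * m) := by gcongr
      _ = _ := by
        rw [← ENNReal.ofReal_mul (by norm_num), ← ENNReal.ofReal_add hm0 (by positivity)]
        congr 1
        ring
  -- Dividing by V = r^n v lowers the exponent from 2n + α to n + α.
  have h7 : 2 * m = V * (2 * M / v * r ^ (n + α)) := by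
    rw [hm, hV, show (2 * n + α : ℝ) = n + (n + α) by ring, Real.rpow_add hr, Real.rpow_natCast]
    field_simp
  rw [h7, ENNReal.ofReal_mul hV0.le] at h6
  exact (ENNReal.mul_le_mul_iff_right (by simpa using hV0) ENNReal.ofReal_ne_top).1 h6

/-- Symbols of commutators that are bounded from `L^p` to weak `L^q` are Hölder continuous. -/
theorem CommutatorBounded.isLip (hΩ : IsCZAngular Ω) {α p q : ℝ} (hα : 0 < α)
    (hp : 1 < p) (hpq : 1 / q = 1 / p - α / n) (hq : 1 < q) {b : 𝔼 n → ℂ}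
    (hb : LocallyIntegrable b) (h : CommutatorBounded Ω b p (weakLpNorm q)) : IsLip α b := by
  obtain ⟨M, hM, hosc⟩ := h.exists_mean_oscillation_le hΩ hp hpq hq hb
  obtain ⟨g, hbg, C, hC⟩ := exists_holder_of_mean_oscillation (μ := volume) hb hα
    -- The closed ball of radius r is placed inside the open ball of radius 2r.
    (M := M * 2 ^ (n + α)) (by positivity) fun x r hr => by
      obtain ⟨c, hc⟩ := hosc x (2 * r) (by positivity)
      refine ⟨c, (lintegral_mono_set
        (Metric.closedBall_subset_ball (by linarith : r < 2 * r))).trans (hc.trans_eq ?_)⟩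
      rw [finrank_euclideanSpace_fin, Real.mul_rpow (by norm_num) hr.le, mul_assoc]
  refine ⟨g, hbg, C, fun x h hh => ?_⟩
  have : 0 < ‖h‖ := norm_pos_iff.2 hh
  rw [div_le_iff₀ (by positivity)]
  exact hC x h hh

end MeanOscillation

/-! ### The equivalence -/

theorem mainTheorem7 (n : ℕ) (Ω : EuclideanSpace ℝ (Fin n) → ℂ) (hΩ : IsCZAngular Ω)
    (α p q : ℝ) (hα₀ : 0 < α) (hα₁ : α < 1) (hp : 1 < p) (hpn : p < n / α)
    (hq : 1 / q = 1 / p - α / n)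
    (b : EuclideanSpace ℝ (Fin n) → ℂ) (hb : LocallyIntegrable b volume) :
    List.TFAE [
      IsLip α b,
      CommutatorBounded Ω b p (fun g => eLpNorm g (ENNReal.ofReal q) volume),
      CommutatorBounded Ω b p (weakLpNorm q)] := by
  have hn : (0 : ℝ) < n := by exact_mod_cast hΩ.dim_pos
  have hp0 : 0 < p := by linarith
  have hq0 : 0 < q := by
    rw [← one_div_pos, hq, sub_pos, div_lt_div_iff₀ hn hp0]
    rw [lt_div_iff₀ hα₀] at hpn
    linarith
  -- Strict inequality is what makes weak L^q functions locally integrable in 3 ⇒ 1.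
  have hq1 : 1 < q := by
    have h1 : 1 / q < 1 := by
      rw [hq]
      have h2 : 1 / p < 1 := by rwa [div_lt_one hp0]
      have h3 : 0 < α / n := by positivity
      linarith
    rwa [div_lt_one hq0] at h1
  tfae_have 1 → 2 := commutatorBounded_of_isLip hΩ hα₀ hp hq hq0
  tfae_have 2 → 3 := CommutatorBounded.weak hq0
  tfae_have 3 → 1 := CommutatorBounded.isLip hΩ hα₀ hp hq hq1 hb
  tfae_finish
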